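/- Let $q$ be a complex number with $0<|q|<1$. For $x\in\mathbb C$ put $(x;q)_n=\prod_{i=0}^{n-1}(1-q^ix)$ and $(x;q)_\infty=\prod_{i\ge0}(1-q^ix)$; for $x\neq0$ put $j(x;q)=(x;q)_\infty(q/x;q)_\infty(q;q)_\infty$. For integers $a$ and $m\ge1$ put $J_{a,m}=j(q^a;q^m)$, $\overline J_{a,m}=j(-q^a;q^m)$ and $J_m=J_{m,3m}$. Let $$g(x,q)=x^{-1}\Big(-1+\sum_{n\ge0}\frac{q^{n^2}}{(x;q)_{n+1}(q/x;q)_n}\Big),\qquad m(x,q,z)=\frac1{j(z;q)}\sum_{r\in\mathbb Z}\frac{(-1)^rq^{r(r-1)/2}z^r}{1-q^{r-1}xz}.$$ The rank of a partition is its largest part minus its number of parts (the empty partition has rank $0$). Let $p(n)$ be the number of partitions of $n$, let $N(a,M;n)$ be the number of partitions of $n$ with rank $\equiv a\pmod M$, and let $$D(a,M)=\sum_{n\ge0}\Big(N(a,M;n)-\frac{p(n)}M\Big)q^n .$$ Then all the series above, as used below, converge absolutely, no denominator below vanishes, and $$D(0,2)=2q\,g(-q,q^4)+\frac12\cdot\frac{J_{1,2}^2}{J_1},\qquad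 D(1,2)=-D(0,2)=-2q\,g(-q,q^4)-\frac12\cdot\frac{J_{1,2}^2}{J_1},$$ $$D(0,3)=2m(q,q^3,-1)-\frac13\cdot\frac{J_{1,2}^2}{\overline J_{1,3}},\qquad D(1,3)=D(2,3)=-\frac{D(0,3)}2=-m(q,q^3,-1)+\frac16\cdot\frac{J_{1,2}^2}{\overline J_{1,3}}.$$ -/

import Mathlib

namespace DysonRank

/-- Dyson's rank of a partition: the largest part minus the number of parts. The empty partition
of `0` has rank `0`. -/
def rank {n : ℕ} (p : Nat.Partition n) : ℤ :=
  (p.parts.sup : ℤ) - (Multiset.card p.parts : ℤ)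

/-- `N(a, M; n)`: the number of partitions of `n` whose rank is congruent to `a` modulo `M`. -/
def rankCount (a : ℤ) (M n : ℕ) : ℕ :=
  (Finset.univ.filter fun p : Nat.Partition n => rank p ≡ a [ZMOD (M : ℤ)]).card

/-- `p(n)`: the number of partitions of `n`. -/
def partitionCount (n : ℕ) : ℕ := Fintype.card (Nat.Partition n)

/-- The `n`-th term `(N(a, M; n) - p(n) / M) q ^ n` of the series `D(a, M)`. -/
noncomputable def deviationTerm (a : ℤ) (M : ℕ) (q : ℂ) (n : ℕ) : ℂ :=
  ((rankCount a M n : ℂ) - (partitionCount n : ℂ) / (M : ℂ)) * q ^ n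

/-- The rank deviation `D(a, M) = ∑_{n ≥ 0} (N(a, M; n) - p(n) / M) q ^ n`. -/
noncomputable def deviation (a : ℤ) (M : ℕ) (q : ℂ) : ℂ :=
  ∑' n : ℕ, deviationTerm a M q n

/-- The finite product `(x; q)_n = ∏_{0 ≤ i < n} (1 - q ^ i x)`. -/
noncomputable def qPoch (x q : ℂ) (n : ℕ) : ℂ := ∏ i ∈ Finset.range n, (1 - q ^ i * x)

/-- The infinite product `(x; q)_∞ = ∏_{i ≥ 0} (1 - q ^ i x)`, for `‖q‖ < 1`. -/
noncomputable def qPochInf (x q : ℂ) : ℂ := ∏' i : ℕ, (1 - q ^ i * x)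

/-- The infinite product defining `(x; q)_∞` converges whenever `‖q‖ < 1`. -/
theorem multipliable_qPochInf (x q : ℂ) (hq : ‖q‖ < 1) :
    Multipliable fun i : ℕ => (1 - q ^ i * x) := by
  have h : Summable fun i : ℕ => ‖-(q ^ i * x)‖ := by
    simp only [norm_neg, norm_mul, norm_pow]
    exact (summable_geometric_of_lt_one (norm_nonneg q) hq).mul_right _
  simpa [sub_eq_add_neg] using multipliable_one_add_of_summable h

/-- The theta function `j(x; q) = (x; q)_∞ (q / x; q)_∞ (q; q)_∞`. -/
noncomputable def theta (x q : ℂ) : ℂ := qPochInf x q * qPochInf (q / x) q * qPochInf q q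

/-- `J_{a,m} = j(q ^ a; q ^ m)`. -/
noncomputable def J (a : ℤ) (m : ℕ) (q : ℂ) : ℂ := theta (q ^ a) (q ^ m)

/-- `J̄_{a,m} = j(-q ^ a; q ^ m)`. -/
noncomputable def Jbar (a : ℤ) (m : ℕ) (q : ℂ) : ℂ := theta (-q ^ a) (q ^ m)

/-- `J_m = J_{m,3m}`. -/
noncomputable def Jsingle (m : ℕ) (q : ℂ) : ℂ := J (m : ℤ) (3 * m) q

/-- The `n`-th term `q ^ (n ^ 2) / ((x; q)_{n+1} (q / x; q)_n)` of the series in `g(x, q)`. -/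
noncomputable def gTerm (x q : ℂ) (n : ℕ) : ℂ :=
  q ^ (n ^ 2) / (qPoch x q (n + 1) * qPoch (q / x) q n)

/-- The universal mock theta function
`g(x, q) = x⁻¹ (-1 + ∑_{n ≥ 0} q ^ (n ^ 2) / ((x; q)_{n+1} (q / x; q)_n))`. -/
noncomputable def g (x q : ℂ) : ℂ := x⁻¹ * (-1 + ∑' n : ℕ, gTerm x q n)

/-- The `r`-th term `(-1) ^ r q ^ (r (r - 1) / 2) z ^ r / (1 - q ^ (r - 1) x z)` of the series in
`m(x, q, z)`; the integer `r (r - 1)` is even, so the division in the exponent is exact. -/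
noncomputable def appellTerm (x q z : ℂ) (r : ℤ) : ℂ :=
  (-1) ^ r * q ^ (r * (r - 1) / 2) * z ^ r / (1 - q ^ (r - 1) * x * z)

/-- The Appell–Lerch sum
`m(x, q, z) = j(z; q)⁻¹ ∑_{r ∈ ℤ} (-1) ^ r q ^ (r (r - 1) / 2) z ^ r / (1 - q ^ (r - 1) x z)`. -/
noncomputable def appell (x q z : ℂ) : ℂ := 1 / theta z q * ∑' r : ℤ, appellTerm x q z r

end DysonRank

namespace DysonRank

open Filter Topology

/-! ### Finite and infinite `q`-shifted factorials -/

/-! Sorting partitions by their largest part gives, for |ζ| = 1, the rank generating function R(ζ) =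
∑ ζ^rank q^n = 1 + ∑_m ζ^m q^(m+1) / (q/ζ; q)_(m+1) (`hasSum_rank`). Detecting residue classes by
roots of unity yields D(a, M) = (1/M) ∑ ζ^(-a) R(ζ) over ζ^M = 1, ζ ≠ 1, since ζ = 1 contributes
exactly p(n)/M. What remains is to evaluate R(-1) and R(ω), with ω a primitive cube root of unity.

R(-1): without its signs the series telescopes, so only the terms of even index have to be summed.
In base q^2 they satisfy a first-order recurrence (`even_lambert_step`). Iterating it produces ∑
(-q)^N q^(N(N-1)) / (-q; q^2)_N, whose terms pair up into the series of g(-q, q^4), together with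
half of the theta series of j(q; q^2). Gauss' identity turns the latter into J_{1,2}^2 / J_1.

R(ω): the Rogers–Fine identity gives the form ∑ q^(n^2) / ((ωq; q)_n (q/ω; q)_n). Partial fractions
(`hasSum_partialFraction`) and Cauchy's identity then make (q; q)_∞ R(ω) a bilateral sum with
denominators 1 - ωq^k. Adding the terms k and -k replaces these by 1 - q^(3k), so that (q; q)_∞ R(ω)
= 1 - 3T (`durfee_cube_root`).

The same T occurs in m(q, q^3, -1). Expanding the Appell–Lerch sum as a double series and comparing
coefficients of z^N gives j(x) ∑ appellTerm = j(z) (Λ - T) + z j'(z), with Λ the Lambert series ∑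
(xz)^s / (1 - q^s) over s ≠ 0 (`hasSum_mul_theta_deriv`). At z = -1 the symmetry of theta gives z
j'(z) = j(-1)/2. After eliminating T, R(ω) - 3m(q, q^3, -1) is a multiple of 1 + 6Λ, which is an
infinite product by Kronecker's formula at a = ω, b = -1 (`one_add_six_lambert`). -/

lemma qPoch_zero (x q : ℂ) : qPoch x q 0 = 1 := by simp [qPoch]

lemma qPoch_succ (x q : ℂ) (n : ℕ) : qPoch x q (n + 1) = qPoch x q n * (1 - q ^ n * x) :=
  Finset.prod_range_succ _ _

lemma qPoch_succ' (x q : ℂ) (n : ℕ) : qPoch x q (n + 1) = (1 - x) * qPoch (q * x) q n := by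
  rw [qPoch, Finset.prod_range_succ', mul_comm, qPoch]
  simp only [pow_zero, one_mul, pow_succ]
  congr 1
  exact Finset.prod_congr rfl fun i _ => by ring

lemma qPoch_add (x q : ℂ) (m n : ℕ) :
    qPoch x q (m + n) = qPoch x q m * qPoch (q ^ m * x) q n := by
  rw [qPoch, Finset.prod_range_add, qPoch, qPoch]
  congr 1
  exact Finset.prod_congr rfl fun i _ => by ring

lemma qPoch_ne_zero {x q : ℂ} (h : ∀ i : ℕ, 1 - q ^ i * x ≠ 0) (n : ℕ) : qPoch x q n ≠ 0 :=
  Finset.prod_ne_zero_iff.2 fun i _ => h i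

lemma tendsto_qPoch (x : ℂ) {q : ℂ} (hq : ‖q‖ < 1) :
    Tendsto (qPoch x q) atTop (𝓝 (qPochInf x q)) :=
  (multipliable_qPochInf x q hq).hasProd.tendsto_prod_nat

lemma qPochInf_eq_mul (x : ℂ) {q : ℂ} (hq : ‖q‖ < 1) (m : ℕ) :
    qPochInf x q = qPoch x q m * qPochInf (q ^ m * x) q := by
  have h1 := (tendsto_qPoch x hq).comp (tendsto_add_atTop_nat m)
  have h2 := (tendsto_qPoch (q ^ m * x) hq).const_mul (qPoch x q m)
  refine tendsto_nhds_unique h1 (h2.congr fun n => ?_)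
  simp only [Function.comp]
  rw [add_comm n m, qPoch_add]

lemma qPochInf_ne_zero {x q : ℂ} (hq : ‖q‖ < 1) (h : ∀ i : ℕ, 1 - q ^ i * x ≠ 0) :
    qPochInf x q ≠ 0 := by
  have hs : Summable fun i : ℕ => ‖-(q ^ i * x)‖ := by
    simp only [norm_neg, norm_mul, norm_pow]
    exact (summable_geometric_of_lt_one (norm_nonneg q) hq).mul_right _
  have := tprod_one_add_ne_zero_of_summable (f := fun i : ℕ => -(q ^ i * x))
    (fun i => by simpa [sub_eq_add_neg] using h i) hs
  simpa [qPochInf, sub_eq_add_neg] using this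

lemma one_sub_pow_mul_ne_zero {x q : ℂ} (hq : ‖q‖ < 1) (hx : ‖x‖ < 1) (i : ℕ) :
    1 - q ^ i * x ≠ 0 := by
  intro h
  have h1 : ‖q ^ i * x‖ = 1 := by rw [← sub_eq_zero.1 h, norm_one]
  rw [norm_mul, norm_pow] at h1
  have : ‖q‖ ^ i ≤ 1 := pow_le_one₀ (norm_nonneg _) hq.le
  nlinarith [norm_nonneg x]

/-- The inverses converge because the infinite product is nonzero. This uniform bound supplies the
majorants for most of the series and remainder estimates below. -/
lemma exists_bound_inv_qPoch {x q : ℂ} (hq : ‖q‖ < 1) (h : ∀ i : ℕ, 1 - q ^ i * x ≠ 0) :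
    ∃ C : ℝ, 0 < C ∧ ∀ n, ‖(qPoch x q n)⁻¹‖ ≤ C := by
  have ht := (tendsto_qPoch x hq).inv₀ (qPochInf_ne_zero hq h)
  obtain ⟨C, hC⟩ := (Metric.isBounded_range_of_tendsto _ ht).exists_norm_le
  exact ⟨max C 1, by positivity, fun n => (hC _ ⟨n, rfl⟩).trans (le_max_left _ _)⟩

/-- The factors are grouped by their index modulo k. -/
lemma qPochInf_mul_split (x : ℂ) {q : ℂ} (hq : ‖q‖ < 1) {k : ℕ} (hk : k ≠ 0) :
    qPochInf x q = ∏ r ∈ Finset.range k, qPochInf (q ^ r * x) (q ^ k) := by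
  have hqk : ‖q ^ k‖ < 1 := by
    rw [norm_pow]; exact pow_lt_one₀ (norm_nonneg _) hq hk
  have h1 := (tendsto_qPoch x hq).comp (tendsto_id.nsmul_atTop (Nat.pos_of_ne_zero hk))
  have h2 := tendsto_finsetProd (Finset.range k)
    fun r _ => tendsto_qPoch (q ^ r * x) hqk
  refine tendsto_nhds_unique h1 (h2.congr fun n => ?_)
  simp only [Function.comp, id, smul_eq_mul]
  induction n with
  | zero => simp [qPoch_zero]
  | succ n ih =>
    rw [mul_add, mul_one, qPoch_add, ← ih]
    simp only [qPoch_succ, Finset.prod_mul_distrib]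
    congr 1
    rw [qPoch]
    exact Finset.prod_congr rfl fun i _ => by ring

/-! ### The coefficients of the theta function -/

/-- The coefficient `(-1) ^ k q ^ (k (k - 1) / 2)` of `z ^ k` in the expansion of `j(z; q)`. -/
noncomputable def thetaCoeff (q : ℂ) (k : ℤ) : ℂ := (-1) ^ k * q ^ (k * (k - 1) / 2)

lemma triangle_add (m n : ℤ) :
    (m + n) * (m + n - 1) / 2 = m * (m - 1) / 2 + n * (n - 1) / 2 + m * n := by
  have hm : 2 ∣ m * (m - 1) := (Int.even_mul_pred_self m).two_dvd
  have hn : 2 ∣ n * (n - 1) := (Int.even_mul_pred_self n).two_dvd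
  have hmn : 2 ∣ (m + n) * (m + n - 1) := (Int.even_mul_pred_self (m + n)).two_dvd
  have : (m + n) * (m + n - 1) = m * (m - 1) + n * (n - 1) + 2 * (m * n) := by ring
  omega

lemma neg_one_zpow_ne_zero (k : ℤ) : (-1 : ℂ) ^ k ≠ 0 := zpow_ne_zero _ (by norm_num)


lemma thetaCoeff_zero (q : ℂ) : thetaCoeff q 0 = 1 := by simp [thetaCoeff]

lemma thetaCoeff_one (q : ℂ) : thetaCoeff q 1 = -1 := by simp [thetaCoeff]

lemma thetaCoeff_ne_zero {q : ℂ} (hq : q ≠ 0) (k : ℤ) : thetaCoeff q k ≠ 0 :=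
  mul_ne_zero (neg_one_zpow_ne_zero k) (zpow_ne_zero _ hq)

/-- The exponent is quadratic, so the coefficients are multiplicative up to the bilinear factor
q^(mn). All later index shifts and reflections rest on this. -/
lemma thetaCoeff_add {q : ℂ} (hq : q ≠ 0) (m n : ℤ) :
    thetaCoeff q (m + n) = thetaCoeff q m * thetaCoeff q n * q ^ (m * n) := by
  rw [thetaCoeff, triangle_add, zpow_add₀ (by norm_num), zpow_add₀ hq, zpow_add₀ hq,
    thetaCoeff, thetaCoeff]
  ring

lemma thetaCoeff_succ {q : ℂ} (hq : q ≠ 0) (k : ℤ) :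
    thetaCoeff q (k + 1) = -(q ^ k * thetaCoeff q k) := by
  rw [thetaCoeff_add hq, thetaCoeff_one, mul_one]; ring

lemma thetaCoeff_pred {q : ℂ} (hq : q ≠ 0) (k : ℤ) :
    thetaCoeff q (k - 1) = -(q ^ (1 - k) * thetaCoeff q k) := by
  have h := thetaCoeff_succ hq (k - 1)
  rw [sub_add_cancel] at h
  rw [h, mul_neg, neg_neg, ← mul_assoc, ← zpow_add₀ hq]
  simp

lemma thetaCoeff_one_sub (q : ℂ) (k : ℤ) : thetaCoeff q (1 - k) = -thetaCoeff q k := by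
  rw [thetaCoeff, thetaCoeff, zpow_sub₀ (by norm_num), zpow_one,
    show (1 - k) * (1 - k - 1) = k * (k - 1) by ring, div_eq_mul_inv, ← zpow_neg,
    ← inv_zpow', inv_neg_one]
  ring

lemma thetaCoeff_neg {q : ℂ} (hq : q ≠ 0) (k : ℤ) :
    thetaCoeff q (-k) = q ^ k * thetaCoeff q k := by
  have h := thetaCoeff_one_sub q (k + 1)
  rw [thetaCoeff_succ hq, neg_neg] at h
  rw [← h]; congr 1; ring

lemma summable_thetaCoeff {q z : ℂ} (hq0 : q ≠ 0) (hq : ‖q‖ < 1) (hz : z ≠ 0) :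
    Summable fun k : ℤ => ‖thetaCoeff q k * z ^ k‖ := by
  have hp : Tendsto (fun n : ℕ => ‖q‖ ^ n) atTop (𝓝 0) :=
    tendsto_pow_atTop_nhds_zero_of_lt_one (norm_nonneg _) hq
  refine Summable.of_nat_of_neg ?_ ?_
  · refine summable_of_ratio_test_tendsto_lt_one (l := 0) zero_lt_one
      (Eventually.of_forall fun n => norm_ne_zero_iff.2 <|
        mul_ne_zero (thetaCoeff_ne_zero hq0 _) (zpow_ne_zero _ hz)) ?_
    have := hp.mul_const ‖z‖
    rw [zero_mul] at this
    refine this.congr fun n => ?_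
    have h1 : ‖thetaCoeff q n * z ^ (n : ℤ)‖ ≠ 0 := norm_ne_zero_iff.2 <|
        mul_ne_zero (thetaCoeff_ne_zero hq0 _) (zpow_ne_zero _ hz)
    rw [norm_norm, norm_norm, eq_div_iff h1, Nat.cast_succ, thetaCoeff_succ hq0, zpow_add_one₀ hz]
    simp only [norm_mul, norm_neg, zpow_natCast, norm_pow]
    ring
  · refine summable_of_ratio_test_tendsto_lt_one (l := 0) zero_lt_one
      (Eventually.of_forall fun n => norm_ne_zero_iff.2 <|
        mul_ne_zero (thetaCoeff_ne_zero hq0 _) (zpow_ne_zero _ hz)) ?_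
    have := (hp.mul_const (‖q‖ * ‖z‖⁻¹))
    rw [zero_mul] at this
    refine this.congr fun n => ?_
    have h1 : ‖thetaCoeff q (-n) * z ^ (-n : ℤ)‖ ≠ 0 := norm_ne_zero_iff.2 <|
        mul_ne_zero (thetaCoeff_ne_zero hq0 _) (zpow_ne_zero _ hz)
    rw [norm_norm, norm_norm, eq_div_iff h1, Nat.cast_succ, neg_add, ← sub_eq_add_neg,
      thetaCoeff_pred hq0, zpow_sub_one₀ hz, show (1 - -(n : ℤ)) = ((n + 1 : ℕ) : ℤ) by
        push_cast; ring]
    simp only [norm_mul, norm_neg, zpow_natCast, norm_pow, norm_inv]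
    ring

/-! ### The finite and the infinite triple product -/

/-- `1 / (q; q)_j`, understood as `0` for `j < 0`. -/
noncomputable def invQFact (q : ℂ) (j : ℤ) : ℂ := if j < 0 then 0 else (qPoch q q j.toNat)⁻¹

lemma invQFact_natCast (q : ℂ) (n : ℕ) : invQFact q n = (qPoch q q n)⁻¹ := by
  simp [invQFact]

lemma invQFact_of_neg (q : ℂ) {j : ℤ} (hj : j < 0) : invQFact q j = 0 := by
  simp [invQFact, hj]

lemma invQFact_pred {q : ℂ} (hq : ‖q‖ < 1) (j : ℤ) :
    invQFact q (j - 1) = (1 - q ^ j) * invQFact q j := by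
  rcases lt_trichotomy j 0 with hj | rfl | hj
  · rw [invQFact_of_neg q hj, invQFact_of_neg q (by omega), mul_zero]
  · simp [invQFact]
  · obtain ⟨n, rfl⟩ : ∃ n : ℕ, j = n + 1 := ⟨(j - 1).toNat, by omega⟩
    have h1 := one_sub_pow_mul_ne_zero hq hq n
    rw [add_sub_cancel_right, invQFact_natCast, ← Nat.cast_succ, invQFact_natCast, qPoch_succ,
      zpow_natCast, Nat.succ_eq_add_one, pow_succ]
    field_simp

/-- `1 / ((q; q)_{n - k} (q; q)_{n + k})`, understood as `0` for `|k| > n`. -/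
noncomputable def invQFactPair (q : ℂ) (n : ℕ) (k : ℤ) : ℂ :=
  invQFact q (n - k) * invQFact q (n + k)

lemma invQFactPair_neg (q : ℂ) (n : ℕ) (k : ℤ) : invQFactPair q n (-k) = invQFactPair q n k := by
  rw [invQFactPair, invQFactPair, sub_neg_eq_add, mul_comm, sub_eq_add_neg]

lemma invQFactPair_eq_zero (q : ℂ) {n : ℕ} {k : ℤ} (h : k ∉ Finset.Icc (-n : ℤ) n) :
    invQFactPair q n k = 0 := by
  rw [Finset.mem_Icc, not_and_or] at h
  rcases h with h | h
  · rw [invQFactPair, invQFact_of_neg q (j := n + k) (by omega), mul_zero]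
  · rw [invQFactPair, invQFact_of_neg q (j := n - k) (by omega), zero_mul]

lemma invQFactPair_zero (q : ℂ) (k : ℤ) : invQFactPair q 0 k = if k = 0 then 1 else 0 := by
  split_ifs with h
  · subst h; simp [invQFactPair, invQFact, qPoch_zero]
  · exact invQFactPair_eq_zero q (by simp; omega)

/-- Drives the inductions on n for both the finite triple product and the partial fractions. -/
lemma invQFactPair_pred {q : ℂ} (hq0 : q ≠ 0) (hq : ‖q‖ < 1) (n : ℕ) (k : ℤ) :
    invQFactPair q n k =
      (1 - q ^ (n + 1) / q ^ k) * (1 - q ^ (n + 1) * q ^ k) * invQFactPair q (n + 1) k := by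
  have h1 := invQFact_pred hq (n + 1 - k)
  have h2 := invQFact_pred hq (n + 1 + k)
  rw [invQFactPair, invQFactPair, show (n : ℤ) - k = n + 1 - k - 1 by ring,
    show (n : ℤ) + k = n + 1 + k - 1 by ring, h1, h2]
  push_cast
  simp only [zpow_sub₀ hq0, zpow_add₀ hq0, zpow_natCast, zpow_one, pow_succ]
  ring

/-- The finite form of the triple product identity. -/
lemma hasSum_finite_triple_product {q z : ℂ} (hq0 : q ≠ 0) (hq : ‖q‖ < 1) (hz : z ≠ 0) (n : ℕ) :
    HasSum (fun k : ℤ => thetaCoeff q k * z ^ k * invQFactPair q n k)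
      (qPoch z q n * qPoch (q / z) q n / qPoch q q (2 * n)) := by
  induction n with
  | zero =>
    simp only [invQFactPair_zero, mul_zero, qPoch_zero]
    convert! hasSum_ite_eq (0 : ℤ) (1 : ℂ) using 1
    · ext k; split_ifs with h <;> simp [h, thetaCoeff_zero]
    · norm_num
  | succ n ih =>
    have hc1 : (1 - q ^ (2 * n) * q) ≠ 0 := one_sub_pow_mul_ne_zero hq hq _
    have hc2 : (1 - q ^ (2 * n + 1) * q) ≠ 0 := one_sub_pow_mul_ne_zero hq hq _
    have hP : qPoch q q (2 * n) ≠ 0 := qPoch_ne_zero (one_sub_pow_mul_ne_zero hq hq) _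
    -- The new factor (1 - zq^n)(1 - q^(n+1)/z) expands to 1 + q^(2n+1) - zq^n - q^(n+1)/z. The last
    -- two terms shift the index k by one, in opposite directions.
    have h1 := ((Equiv.subRight (1 : ℤ)).hasSum_iff.2 ih).mul_left (-(z * q ^ n))
    have h2 := ((Equiv.addRight (1 : ℤ)).hasSum_iff.2 ih).mul_left (-(q ^ (n + 1) / z))
    have h3 := ((ih.mul_left (1 + q ^ (2 * n + 1))).add (h1.add h2)).mul_left
      ((1 - q ^ (2 * n) * q)⁻¹ * (1 - q ^ (2 * n + 1) * q)⁻¹)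
    convert! h3 using 1
    · ext k
      simp only [Function.comp, Equiv.subRight_apply, Equiv.coe_addRight]
      have e1 : invQFactPair q n (k - 1) =
          (1 - q ^ (n + 1) * q ^ k) * (1 - q ^ n * q ^ k) * invQFactPair q (n + 1) k := by
        have a1 := invQFact_pred hq (n + 1 + k)
        have a2 := invQFact_pred hq (n + k)
        rw [invQFactPair, invQFactPair, show (n : ℤ) + (k - 1) = n + k - 1 by ring, a2,
          show (n : ℤ) + k = n + 1 + k - 1 by ring, a1, zpow_sub_one₀ hq0, zpow_add₀ hq0,
          zpow_add_one₀ hq0, zpow_natCast]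
        push_cast
        rw [show (n : ℤ) - (k - 1) = n + 1 - k by ring]
        field_simp
        ring
      have e2 : invQFactPair q n (k + 1) =
          (1 - q ^ (n + 1) / q ^ k) * (1 - q ^ n / q ^ k) * invQFactPair q (n + 1) k := by
        have a1 := invQFact_pred hq (n + 1 - k)
        have a2 := invQFact_pred hq (n - k)
        rw [invQFactPair, invQFactPair, show (n : ℤ) - (k + 1) = n - k - 1 by ring, a2,
          show (n : ℤ) - k = n + 1 - k - 1 by ring, a1, zpow_sub_one₀ hq0, zpow_sub₀ hq0,
          zpow_add_one₀ hq0, zpow_natCast]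
        push_cast
        rw [show (n : ℤ) + (k + 1) = n + 1 + k by ring]
        field_simp
        ring
      rw [e1, e2, invQFactPair_pred hq0 hq n k, thetaCoeff_pred hq0, thetaCoeff_succ hq0,
        zpow_sub_one₀ hz, zpow_add_one₀ hz, zpow_sub₀ hq0, zpow_one]
      have hqk : q ^ k ≠ 0 := zpow_ne_zero _ hq0
      simp only [pow_succ, pow_mul'] at hc1 hc2 ⊢
      generalize q ^ k = u at *
      generalize q ^ n = a at *
      simp only [pow_zero, one_mul] at *
      rw [← mul_inv, eq_inv_mul_iff_mul_eq₀ (mul_ne_zero hc1 hc2)]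
      field_simp
      ring
    · rw [show 2 * (n + 1) = 2 * n + 1 + 1 by ring, qPoch_succ, qPoch_succ, qPoch_succ,
        qPoch_succ q q (2 * n)]
      field_simp
      ring

lemma exists_bound_invQFactPair {q : ℂ} (hq : ‖q‖ < 1) :
    ∃ C : ℝ, 0 < C ∧ ∀ n k, ‖invQFactPair q n k‖ ≤ C := by
  obtain ⟨C, hC, h⟩ := exists_bound_inv_qPoch hq (one_sub_pow_mul_ne_zero hq hq)
  have h' (j : ℤ) : ‖invQFact q j‖ ≤ C := by
    rw [invQFact]; split_ifs
    · simpa using hC.le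
    · exact h _
  refine ⟨C * C, by positivity, fun n k => ?_⟩
  rw [invQFactPair, norm_mul]
  exact mul_le_mul (h' _) (h' _) (norm_nonneg _) hC.le

lemma tendsto_invQFactPair {q : ℂ} (hq : ‖q‖ < 1) (k : ℤ) :
    Tendsto (fun n => invQFactPair q n k) atTop (𝓝 ((qPochInf q q)⁻¹ * (qPochInf q q)⁻¹)) := by
  have h (k : ℤ) : Tendsto (fun n : ℕ => invQFact q (n + k)) atTop (𝓝 (qPochInf q q)⁻¹) := by
    have ht := (tendsto_qPoch q hq).inv₀
      (qPochInf_ne_zero hq (one_sub_pow_mul_ne_zero hq hq))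
    have hk : Tendsto (fun n : ℕ => ((n : ℤ) + k).toNat) atTop atTop :=
      tendsto_atTop_atTop.2 fun b => ⟨b + k.natAbs, fun n hn => by omega⟩
    refine (ht.comp hk).congr' ?_
    filter_upwards [eventually_ge_atTop k.natAbs] with n hn
    simp only [Function.comp, invQFact]
    rw [if_neg (by omega)]
  simpa [invQFactPair, sub_eq_add_neg] using (h (-k)).mul (h k)

/-- Jacobi's triple product identity. -/
theorem hasSum_theta {q z : ℂ} (hq0 : q ≠ 0) (hq : ‖q‖ < 1) (hz : z ≠ 0) :
    HasSum (fun k : ℤ => thetaCoeff q k * z ^ k) (theta z q) := by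
  have hE : qPochInf q q ≠ 0 := qPochInf_ne_zero hq (one_sub_pow_mul_ne_zero hq hq)
  have hs := summable_thetaCoeff hq0 hq hz
  obtain ⟨C, hC, hb⟩ := exists_bound_invQFactPair hq
  have h1 : Tendsto (fun n : ℕ => ∑' k : ℤ, thetaCoeff q k * z ^ k * invQFactPair q n k) atTop
      (𝓝 (∑' k : ℤ, thetaCoeff q k * z ^ k * ((qPochInf q q)⁻¹ * (qPochInf q q)⁻¹))) := by
    refine tendsto_tsum_of_dominated_convergence (hs.mul_right C)
      (fun k => (tendsto_invQFactPair hq k).const_mul _) (Eventually.of_forall fun n k => ?_)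
    rw [norm_mul]
    exact mul_le_mul_of_nonneg_left (hb n k) (norm_nonneg _)
  have h2 : Tendsto (fun n : ℕ => ∑' k : ℤ, thetaCoeff q k * z ^ k * invQFactPair q n k) atTop
      (𝓝 (qPochInf z q * qPochInf (q / z) q / qPochInf q q)) := by
    simp only [fun n => (hasSum_finite_triple_product hq0 hq hz n).tsum_eq]
    exact ((tendsto_qPoch z hq).mul (tendsto_qPoch (q / z) hq)).div
      ((tendsto_qPoch q hq).comp (tendsto_id.nsmul_atTop two_pos)) hE
  have h3 := tendsto_nhds_unique h1 h2
  rw [tsum_mul_right] at h3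
  have h4 : ∑' k : ℤ, thetaCoeff q k * z ^ k = theta z q := by
    rw [theta]
    field_simp at h3
    linear_combination h3
  exact h4 ▸ hs.of_norm.hasSum

/-! ### The case `a = 0` of the Rogers–Fine identity -/

lemma choose_two_succ (n : ℕ) : (n + 1).choose 2 = n + n.choose 2 := by
  rw [Nat.choose_succ_succ' n 1, Nat.choose_one_right]

lemma two_mul_choose_two_add (n : ℕ) : 2 * n.choose 2 + n = n ^ 2 := by
  induction n with
  | zero => simp
  | succ n ih => rw [choose_two_succ]; linarith [ih, add_sq n 1]

lemma summable_pow_mul_pow_choose_two (x : ℂ) {q : ℂ} (hq : ‖q‖ < 1) :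
    Summable fun n : ℕ => ‖x ^ n * q ^ n.choose 2‖ := by
  have hp : Tendsto (fun n : ℕ => ‖x‖ * ‖q‖ ^ n) atTop (𝓝 0) := by
    simpa using (tendsto_pow_atTop_nhds_zero_of_lt_one (norm_nonneg _) hq).const_mul ‖x‖
  refine summable_of_ratio_norm_eventually_le (r := 1 / 2) (by norm_num) ?_
  filter_upwards [hp.eventually_le_const (show (0 : ℝ) < 1 / 2 by norm_num)] with n hn
  rw [norm_norm, norm_norm, choose_two_succ, pow_succ, pow_add,
    show x ^ n * x * (q ^ n * q ^ n.choose 2) = (x * q ^ n) * (x ^ n * q ^ n.choose 2) by ring,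
    norm_mul (x * q ^ n), norm_mul x, norm_pow]
  gcongr

lemma norm_sq_lt_one {q : ℂ} (hq : ‖q‖ < 1) : ‖q ^ 2‖ < 1 := by
  rw [norm_pow]; exact pow_lt_one₀ (norm_nonneg _) hq two_ne_zero

lemma norm_mul_pow_le (x : ℂ) {q : ℂ} (hq : ‖q‖ < 1) (n : ℕ) : ‖x * q ^ n‖ ≤ ‖x‖ := by
  rw [norm_mul, norm_pow]
  exact mul_le_of_le_one_right (norm_nonneg _) (pow_le_one₀ (norm_nonneg _) hq.le)

lemma norm_pow_div_qPoch_le {q c T : ℂ} (hq : ‖q‖ < 1) {C : ℝ}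
    (hC : ∀ n, ‖(qPoch c q n)⁻¹‖ ≤ C) (N m : ℕ) :
    ‖(T * q ^ N) ^ m / qPoch c q (N + m)‖ ≤ ‖T‖ ^ m * C := by
  rw [div_eq_mul_inv, norm_mul, norm_pow]
  exact mul_le_mul (pow_le_pow_left₀ (norm_nonneg _) (norm_mul_pow_le T hq N) m) (hC _)
    (norm_nonneg _) (by positivity)

lemma summable_pow_div_qPoch {q c T : ℂ} (hq : ‖q‖ < 1) (hT : ‖T‖ < 1)
    (hc : ∀ i : ℕ, 1 - q ^ i * c ≠ 0) (N : ℕ) :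
    Summable fun m : ℕ => (T * q ^ N) ^ m / qPoch c q (N + m) := by
  obtain ⟨C, -, hC⟩ := exists_bound_inv_qPoch hq hc
  exact Summable.of_norm_bounded ((summable_geometric_of_lt_one (norm_nonneg _) hT).mul_right C)
    (norm_pow_div_qPoch_le hq hC N)

/-- Subtracting the series times q^N T from its own tail leaves 1/(c)_(N+m+1) - 1/(c)_(N+m) =
cq^(N+m)/(c)_(N+m+1), whose extra power q^m turns T q^N into T q^(N+1). -/
lemma rogersFine_step {q c T : ℂ} (hq : ‖q‖ < 1) (hT : ‖T‖ < 1)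
    (hc : ∀ i : ℕ, 1 - q ^ i * c ≠ 0) (N : ℕ) :
    (1 - q ^ N * T) * ∑' m : ℕ, (T * q ^ N) ^ m / qPoch c q (N + m) =
      (qPoch c q N)⁻¹ + c * T * q ^ (2 * N) *
        ∑' m : ℕ, (T * q ^ (N + 1)) ^ m / qPoch c q (N + 1 + m) := by
  have hs := summable_pow_div_qPoch hq hT hc N
  have hs' := (summable_nat_add_iff 1).2 hs
  rw [sub_mul, one_mul, hs.tsum_eq_zero_add, add_sub_assoc, ← hs.tsum_eq_zero_add,
    ← tsum_mul_left, ← hs'.tsum_sub (hs.mul_left _), ← tsum_mul_left]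
  congr 1
  · simp
  · refine tsum_congr fun m => ?_
    have h1 := qPoch_ne_zero hc (N + m)
    have h2 := hc (N + m)
    rw [← add_assoc, show N + 1 + m = N + m + 1 by ring, qPoch_succ]
    field_simp
    ring

lemma rogersFine_partial {q c T : ℂ} (hq : ‖q‖ < 1) (hT : ‖T‖ < 1)
    (hc : ∀ i : ℕ, 1 - q ^ i * c ≠ 0) (N : ℕ) :
    ∑' m : ℕ, T ^ m / qPoch c q m =
      ∑ n ∈ Finset.range N, (c * T) ^ n * (q ^ 2) ^ n.choose 2 /
        (qPoch c q n * qPoch T q (n + 1)) +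
      (c * T) ^ N * (q ^ 2) ^ N.choose 2 * (qPoch T q N)⁻¹ *
        ∑' m : ℕ, (T * q ^ N) ^ m / qPoch c q (N + m) := by
  induction N with
  | zero => simp [qPoch_zero]
  | succ N ih =>
    have h := rogersFine_step hq hT hc N
    have h1 := qPoch_ne_zero hc N
    have h2 := qPoch_ne_zero (one_sub_pow_mul_ne_zero hq hT) N
    have h3 := one_sub_pow_mul_ne_zero hq hT N
    rw [ih, Finset.sum_range_succ, add_assoc]
    congr 1
    rw [← eq_inv_mul_iff_mul_eq₀ h3] at h
    rw [h, qPoch_succ T, choose_two_succ, pow_succ, pow_add]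
    field_simp
    ring

/-- The Rogers–Fine identity for `∑ T ^ m / (c; q)_m`. -/
theorem hasSum_rogersFine {q c T : ℂ} (hq : ‖q‖ < 1) (hT : ‖T‖ < 1)
    (hc : ∀ i : ℕ, 1 - q ^ i * c ≠ 0) :
    HasSum (fun n : ℕ => (c * T) ^ n * (q ^ 2) ^ n.choose 2 /
        (qPoch c q n * qPoch T q (n + 1))) (∑' m : ℕ, T ^ m / qPoch c q m) := by
  obtain ⟨C, hC0, hC⟩ := exists_bound_inv_qPoch hq hc
  obtain ⟨D, hD0, hD⟩ := exists_bound_inv_qPoch hq (one_sub_pow_mul_ne_zero hq hT)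
  have hsum := summable_pow_mul_pow_choose_two (c * T) (norm_sq_lt_one hq)
  have hs : Summable fun n : ℕ => (c * T) ^ n * (q ^ 2) ^ n.choose 2 /
      (qPoch c q n * qPoch T q (n + 1)) := by
    refine Summable.of_norm_bounded (hsum.mul_right (C * D)) fun n => ?_
    rw [div_eq_mul_inv, norm_mul, mul_inv, norm_mul (qPoch c q n)⁻¹]
    exact mul_le_mul_of_nonneg_left (mul_le_mul (hC _) (hD _) (norm_nonneg _) hC0.le)
      (norm_nonneg _)
  have hr : Tendsto (fun N : ℕ => (c * T) ^ N * (q ^ 2) ^ N.choose 2 * (qPoch T q N)⁻¹ *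
        ∑' m : ℕ, (T * q ^ N) ^ m / qPoch c q (N + m)) atTop (𝓝 0) := by
    have h0 : Tendsto (fun N : ℕ => ‖(c * T) ^ N * (q ^ 2) ^ N.choose 2‖ * D *
        ∑' m : ℕ, ‖T‖ ^ m * C) atTop (𝓝 0) := by
      simpa using (hsum.tendsto_atTop_zero.mul_const D).mul_const (∑' m : ℕ, ‖T‖ ^ m * C)
    refine squeeze_zero_norm (fun N => ?_) h0
    rw [norm_mul, norm_mul ((c * T) ^ N * (q ^ 2) ^ N.choose 2)]
    refine mul_le_mul (mul_le_mul_of_nonneg_left (hD _) (norm_nonneg _)) ?_ (norm_nonneg _)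
      (by positivity)
    exact tsum_of_norm_bounded
      ((summable_geometric_of_lt_one (norm_nonneg _) hT).mul_right C).hasSum
      (norm_pow_div_qPoch_le hq hC N)
  have h := hs.hasSum.tendsto_sum_nat.add hr
  have h' := tendsto_nhds_unique (tendsto_const_nhds.congr (rogersFine_partial hq hT hc)) h
  rw [h', add_zero]
  exact hs.hasSum

lemma hasSum_telescope_inv_qPoch {q c : ℂ} (hq : ‖q‖ < 1) (hc : ∀ i : ℕ, 1 - q ^ i * c ≠ 0) :
    HasSum (fun m : ℕ => c * q ^ m / qPoch c q (m + 1)) ((qPochInf c q)⁻¹ - 1) := by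
  have hs : Summable fun m : ℕ => c * q ^ m / qPoch c q (m + 1) := by
    obtain ⟨C, -, hC⟩ := exists_bound_inv_qPoch hq hc
    refine Summable.of_norm_bounded
      (((summable_geometric_of_lt_one (norm_nonneg _) hq).mul_left ‖c‖).mul_right C) fun m => ?_
    rw [div_eq_mul_inv, norm_mul, norm_mul, norm_pow]
    exact mul_le_mul_of_nonneg_left (hC _) (by positivity)
  have h1 := ((tendsto_qPoch c hq).inv₀ (qPochInf_ne_zero hq hc)).sub_const 1
  have h2 : ∑' m : ℕ, c * q ^ m / qPoch c q (m + 1) = (qPochInf c q)⁻¹ - 1 := by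
    refine tendsto_nhds_unique hs.hasSum.tendsto_sum_nat (h1.congr fun n => ?_)
    have : ∀ m, c * q ^ m / qPoch c q (m + 1) = (qPoch c q (m + 1))⁻¹ - (qPoch c q m)⁻¹ := by
      intro m
      have h1 := qPoch_ne_zero hc m
      have h2 : 1 - c * q ^ m ≠ 0 := by rw [mul_comm]; exact hc m
      rw [qPoch_succ, mul_comm (q ^ m)]
      field_simp
      ring
    simp only [this, Finset.sum_range_sub (fun m => (qPoch c q m)⁻¹), qPoch_zero, inv_one]
  exact h2 ▸ hs.hasSum

lemma one_sub_pow_mul_shift {q c : ℂ} (hc : ∀ i : ℕ, 1 - q ^ i * c ≠ 0) (i : ℕ) :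
    1 - q ^ i * (q * c) ≠ 0 := by
  have := hc (i + 1)
  rwa [pow_succ, mul_assoc] at this

/-- Cauchy's identity. -/
theorem hasSum_cauchy {q c : ℂ} (hq : ‖q‖ < 1) (hc : ∀ i : ℕ, 1 - q ^ i * c ≠ 0) :
    HasSum (fun n : ℕ => c ^ n * (q ^ 2) ^ n.choose 2 / (qPoch c q n * qPoch q q n))
      (qPochInf c q)⁻¹ := by
  have h0 : 1 - c ≠ 0 := by simpa using hc 0
  -- With T = q and c replaced by qc, the left side of Rogers–Fine is a telescoping series after
  -- multiplication by c/(1 - c).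
  have h1 := (hasSum_rogersFine hq hq (one_sub_pow_mul_shift hc)).mul_left (c / (1 - c))
  rw [← hasSum_nat_add_iff' 1]
  have h2 : c / (1 - c) * ∑' m : ℕ, q ^ m / qPoch (q * c) q m = (qPochInf c q)⁻¹ - 1 := by
    rw [← tsum_mul_left, ← (hasSum_telescope_inv_qPoch hq hc).tsum_eq]
    refine tsum_congr fun m => ?_
    rw [qPoch_succ', div_mul_div_comm]
  rw [h2] at h1
  convert! h1 using 1
  · ext n
    rw [qPoch_succ', choose_two_succ, div_mul_div_comm]
    congr 1 <;> ring
  · simp [qPoch_zero]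

/-! ### The generating function of ranks as an Appell–Lerch series -/

/-- Rogers–Fine with T = xq and c = q^2/x: here cT = q^3, and the shift of the index by one
completes the exponent to n^2. It connects the largest-part form of R(x) with its Durfee-square
form. -/
lemma hasSum_durfee {q x : ℂ} (hx : x ≠ 0) (hq : ‖q‖ < 1) (hxq : ‖x * q‖ < 1)
    (hc : ∀ i : ℕ, 1 - q ^ i * (q / x) ≠ 0) :
    HasSum (fun n : ℕ => q ^ n ^ 2 / (qPoch (x * q) q n * qPoch (q / x) q n))
      (1 + ∑' m : ℕ, x ^ m * q ^ (m + 1) / qPoch (q / x) q (m + 1)) := by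
  have h0 : 1 - q / x ≠ 0 := by simpa using hc 0
  have h1 := (hasSum_rogersFine hq hxq (one_sub_pow_mul_shift hc)).mul_left (q / (1 - q / x))
  rw [← hasSum_nat_add_iff' 1]
  convert! h1 using 1
  · ext n
    rw [qPoch_succ' (q / x), div_mul_div_comm,
      show q * (q / x) * (x * q) = q ^ 3 by field_simp, ← pow_mul, ← pow_mul,
      ← two_mul_choose_two_add (n + 1), choose_two_succ]
    congr 1 <;> ring
  · rw [← tsum_mul_left]
    simp only [Finset.range_one, Finset.sum_singleton, qPoch_zero]
    norm_num
    refine tsum_congr fun m => ?_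
    rw [qPoch_succ' (q / x), div_mul_div_comm]
    congr 1; ring

/-- The inverses tend to 1 as k → ∞ and to 0 as k → -∞. A vanishing 1 - xq^k is harmless because its
inverse is 0; the Lambert series below use this at x = 1. -/
lemma exists_bound_inv_one_sub_zpow {q x : ℂ} (hq0 : q ≠ 0) (hq : ‖q‖ < 1) (hx : x ≠ 0) :
    ∃ C : ℝ, 0 < C ∧ ∀ k : ℤ, ‖(1 - x * q ^ k)⁻¹‖ ≤ C := by
  have hp := tendsto_pow_atTop_nhds_zero_of_norm_lt_one hq
  have h1 : Tendsto (fun n : ℕ => (1 - x * q ^ n)⁻¹) atTop (𝓝 (1 - x * 0)⁻¹) :=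
    ((hp.const_mul x).const_sub 1).inv₀ (by simp)
  have h2 : Tendsto (fun n : ℕ => q ^ n * (q ^ n - x)⁻¹) atTop (𝓝 (0 * (0 - x)⁻¹)) :=
    hp.mul ((hp.sub_const x).inv₀ (by simpa using hx))
  obtain ⟨C, hC⟩ := (Metric.isBounded_range_of_tendsto _ h1).exists_norm_le
  obtain ⟨D, hD⟩ := (Metric.isBounded_range_of_tendsto _ h2).exists_norm_le
  refine ⟨max 1 (max C D), by positivity, fun k => le_max_of_le_right ?_⟩
  obtain ⟨n, rfl | rfl⟩ := k.eq_nat_or_neg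
  · exact le_max_of_le_left (by simpa using hC _ ⟨n, rfl⟩)
  · refine le_max_of_le_right (le_trans (le_of_eq ?_) (hD _ ⟨n, rfl⟩))
    have : q ^ n ≠ 0 := pow_ne_zero _ hq0
    change _ = ‖q ^ n * (q ^ n - x)⁻¹‖
    rw [zpow_neg, zpow_natCast, show 1 - x * (q ^ n)⁻¹ = (q ^ n - x) * (q ^ n)⁻¹ by field_simp,
      mul_inv, inv_inv, mul_comm]

/-- The coefficients in the partial fraction expansion of `1 / ((xq; q)_n (q/x; q)_n)`. -/
noncomputable def partialFractionCoeff (x q : ℂ) (k : ℤ) : ℂ :=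
  thetaCoeff q k * q ^ k * ((1 - x) * (1 - x * q ^ k)⁻¹)

/-- Put Q = q^(n+1). Then (1 - xQ)(1 - Q/x) - (1 - Qq^k)(1 - Q/q^k) = Q q^(-k) (1 - xq^k)(1 -
q^k/x), so the error in the induction has no pole. It is a combination of the finite triple products
at z = 1 and z = q, and both vanish. -/
lemma hasSum_partialFraction {q x : ℂ} (hq0 : q ≠ 0) (hq : ‖q‖ < 1) (hx0 : x ≠ 0)
    (hx : ∀ k : ℤ, 1 - x * q ^ k ≠ 0) (n : ℕ) :
    HasSum (fun k => partialFractionCoeff x q k * invQFactPair q n k)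
      (qPoch (x * q) q n * qPoch (q / x) q n)⁻¹ := by
  induction n with
  | zero =>
    simp only [invQFactPair_zero, qPoch_zero]
    convert! hasSum_ite_eq (0 : ℤ) (1 : ℂ) using 1
    · ext k
      have := hx 0
      split_ifs with h
      · simp only [h, partialFractionCoeff, thetaCoeff_zero, zpow_zero, mul_one] at this ⊢
        field_simp
      · simp
    · norm_num
  | succ n ih =>
    have ha : (1 - x * q ^ (n + 1)) ≠ 0 := by
      have := hx ((n + 1 : ℕ) : ℤ)
      rwa [zpow_natCast] at this
    have hb : (1 - q ^ (n + 1) / x) ≠ 0 := by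
      intro h
      refine hx (-(n + 1 : ℕ)) ?_
      have hqn : q ^ (n + 1) ≠ 0 := pow_ne_zero _ hq0
      rw [zpow_neg, zpow_natCast]
      field_simp at h ⊢
      linear_combination -h
    have z1 : HasSum (fun k => thetaCoeff q k * invQFactPair q (n + 1) k) 0 := by
      simpa [qPoch_succ'] using hasSum_finite_triple_product hq0 hq one_ne_zero (n + 1)
    have z2 : HasSum (fun k => thetaCoeff q k * q ^ k * invQFactPair q (n + 1) k) 0 := by
      simpa [qPoch_succ' 1, div_self hq0] using
        hasSum_finite_triple_product hq0 hq hq0 (n + 1)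
    have h := (ih.add ((z1.sub (z2.mul_left x⁻¹)).mul_left ((1 - x) * q ^ (n + 1)))).mul_left
      ((1 - x * q ^ (n + 1))⁻¹ * (1 - q ^ (n + 1) / x)⁻¹)
    convert! h using 1
    · ext k
      rw [← mul_inv, eq_inv_mul_iff_mul_eq₀ (mul_ne_zero ha hb), invQFactPair_pred hq0 hq n k,
        partialFractionCoeff]
      have h1 := hx k
      have h2 : q ^ k ≠ 0 := zpow_ne_zero _ hq0
      generalize q ^ k = u at *
      field_simp
      ring
    · rw [qPoch_succ, qPoch_succ, show q ^ n * (x * q) = x * q ^ (n + 1) by ring,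
        show q ^ n * (q / x) = q ^ (n + 1) / x by ring]
      simp only [mul_inv]
      ring

lemma hasSum_pow_sq_mul_invQFactPair {q : ℂ} (hq : ‖q‖ < 1) (k : ℤ) :
    HasSum (fun n : ℕ => q ^ n ^ 2 * invQFactPair q n k) (q ^ (k * k) * (qPochInf q q)⁻¹) := by
  suffices H : ∀ k : ℕ, HasSum (fun n : ℕ => q ^ n ^ 2 * invQFactPair q n k)
      (q ^ ((k : ℤ) * k) * (qPochInf q q)⁻¹) by
    obtain ⟨m, rfl | rfl⟩ := k.eq_nat_or_neg
    · exact H m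
    · simpa only [invQFactPair_neg, neg_mul_neg] using H m
  intro k
  have hqq := one_sub_pow_mul_ne_zero hq hq
  -- The terms with n < k vanish. Writing n = m + k, the rest is Cauchy's series with c = q^(2k+1).
  have hc : ∀ i : ℕ, 1 - q ^ i * (q ^ (2 * k) * q) ≠ 0 := fun i => by
    have := hqq (i + 2 * k)
    rwa [pow_add, mul_assoc] at this
  have h := (hasSum_cauchy hq hc).mul_left (q ^ k ^ 2 / qPoch q q (2 * k))
  rw [← hasSum_nat_add_iff' k]
  convert! h using 1
  · ext m
    rw [invQFactPair, show ((m + k : ℕ) : ℤ) - k = m by push_cast; ring,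
      show ((m + k : ℕ) : ℤ) + k = (2 * k + m : ℕ) by push_cast; ring, invQFact_natCast,
      invQFact_natCast, qPoch_add, div_mul_div_comm, ← mul_inv, ← div_eq_mul_inv]
    congr 1
    · rw [← pow_mul, add_sq, ← two_mul_choose_two_add m]; ring
    · ring
  · rw [Finset.sum_eq_zero fun i hi => ?_, sub_zero, qPochInf_eq_mul q hq (2 * k), mul_inv,
      ← Nat.cast_mul, zpow_natCast, sq]
    · ring
    · rw [Finset.mem_range] at hi
      rw [invQFactPair_eq_zero q (by simp; omega), mul_zero]

/-- The Appell–Lerch form of the generating function of ranks. -/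
theorem hasSum_rank_appellLerch {q x : ℂ} (hq0 : q ≠ 0) (hq : ‖q‖ < 1) (hx0 : x ≠ 0)
    (hx : ∀ k : ℤ, 1 - x * q ^ k ≠ 0) :
    HasSum (fun k : ℤ => partialFractionCoeff x q k * q ^ (k * k))
      (qPochInf q q * ∑' n : ℕ, q ^ n ^ 2 / (qPoch (x * q) q n * qPoch (q / x) q n)) := by
  obtain ⟨C, hC0, hC⟩ := exists_bound_inv_one_sub_zpow hq0 hq hx0
  obtain ⟨D, hD0, hD⟩ := exists_bound_invQFactPair hq
  have hE : qPochInf q q ≠ 0 := qPochInf_ne_zero hq (one_sub_pow_mul_ne_zero hq hq)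
  have hα : Summable fun k : ℤ => ‖partialFractionCoeff x q k‖ := by
    refine Summable.of_nonneg_of_le (fun _ => norm_nonneg _) (fun k => ?_)
      ((summable_thetaCoeff hq0 hq hq0).mul_right (‖1 - x‖ * C))
    rw [partialFractionCoeff, norm_mul, norm_mul (1 - x)]
    gcongr
    exact hC k
  have hn : Summable fun n : ℕ => ‖q ^ n ^ 2‖ := by
    refine (summable_pow_mul_pow_choose_two q (norm_sq_lt_one hq)).congr fun n => ?_
    rw [← two_mul_choose_two_add, pow_add, pow_mul, mul_comm]
  have hF : Summable fun p : ℕ × ℤ =>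
      q ^ p.1 ^ 2 * (partialFractionCoeff x q p.2 * invQFactPair q p.1 p.2) := by
    refine Summable.of_norm_bounded ((hn.mul_of_nonneg hα (fun _ => norm_nonneg _)
      (fun _ => norm_nonneg _)).mul_right D) fun p => ?_
    rw [norm_mul, norm_mul (partialFractionCoeff x q p.2), ← mul_assoc]
    gcongr
    exact hD _ _
  have h1 := hF.hasSum.prod_fiberwise fun n =>
    (hasSum_partialFraction hq0 hq hx0 hx n).mul_left (q ^ n ^ 2)
  have h2 := ((Equiv.prodComm ℤ ℕ).hasSum_iff.2 hF.hasSum).prod_fiberwise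
    (g := fun k => partialFractionCoeff x q k * (q ^ (k * k) * (qPochInf q q)⁻¹)) fun k => by
      convert! (hasSum_pow_sq_mul_invQFactPair hq k).mul_left (partialFractionCoeff x q k) using 1
      ext n
      simp only [Function.comp, Equiv.prodComm_apply, Prod.swap]
      ring
  have h3 := h2.mul_left (qPochInf q q)
  rw [← h1.tsum_eq] at h3
  convert! h3 using 1
  ext k
  field_simp

/-! ### Ranks modulo two -/

lemma hasSum_telescope {u : ℕ → ℂ} {l : ℂ} (hs : Summable fun k => u k - u (k + 1))
    (hu : Tendsto u atTop (𝓝 l)) : HasSum (fun k => u k - u (k + 1)) (u 0 - l) := by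
  have h : Tendsto (fun n => u 0 - u n) atTop (𝓝 (u 0 - l)) := hu.const_sub _
  have := tendsto_nhds_unique hs.hasSum.tendsto_sum_nat
    (h.congr fun n => (Finset.sum_range_sub' u n).symm)
  exact this ▸ hs.hasSum

lemma one_sub_pow_mul_neg_ne_zero {q : ℂ} (hq : ‖q‖ < 1) (i : ℕ) : 1 - q ^ i * -q ≠ 0 :=
  one_sub_pow_mul_ne_zero hq (by rwa [norm_neg]) i

/-- The alternating sum is the full sum minus twice its odd-indexed part. The full sum telescopes,
and the odd-indexed part is the series on the right without its term k = 0. -/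
lemma alternating_fine_eq {q : ℂ} (hq : ‖q‖ < 1) :
    1 + ∑' m : ℕ, (-1) ^ m * q ^ (m + 1) / qPoch (-q) q (m + 1) =
      4 - (qPochInf (-q) q)⁻¹ - 2 * ∑' k : ℕ, q ^ (2 * k) / qPoch (-q) q (2 * k) := by
  obtain ⟨C, hC0, hC⟩ := exists_bound_inv_qPoch hq (one_sub_pow_mul_neg_ne_zero hq)
  set d : ℕ → ℂ := fun m => q ^ (m + 1) / qPoch (-q) q (m + 1) with hd
  have hdn : Summable fun m => ‖d m‖ := by
    refine Summable.of_nonneg_of_le (fun _ => norm_nonneg _) (fun m => ?_)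
      (((summable_geometric_of_lt_one (norm_nonneg _) hq).mul_left ‖q‖).mul_right C)
    simp only [hd]
    rw [div_eq_mul_inv, norm_mul, pow_succ', norm_mul, norm_pow]
    exact mul_le_mul_of_nonneg_left (hC _) (by positivity)
  have hd1 : HasSum d (1 - (qPochInf (-q) q)⁻¹) := by
    convert! (hasSum_telescope_inv_qPoch hq (one_sub_pow_mul_neg_ne_zero hq)).neg using 1
    · ext m; simp only [hd]; ring
    · ring
  have he : Summable fun k => d (2 * k) :=
    hdn.of_norm.comp_injective fun a b h => by simpa using h
  have ho : Summable fun k => d (2 * k + 1) :=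
    hdn.of_norm.comp_injective fun a b h => by simpa using h
  have h1 := (he.hasSum.even_add_odd ho.hasSum).unique hd1
  have h2 : HasSum (fun m : ℕ => (-1) ^ m * q ^ (m + 1) / qPoch (-q) q (m + 1))
      (∑' k, d (2 * k) + -∑' k, d (2 * k + 1)) := by
    refine HasSum.even_add_odd ?_ ?_
    · convert! he.hasSum using 1
      ext k
      simp [hd, pow_mul]
    · convert! ho.hasSum.neg using 1
      ext k
      simp [hd, pow_succ, pow_mul, neg_div]
  have hK : Summable fun k : ℕ => q ^ (2 * k) / qPoch (-q) q (2 * k) :=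
    (summable_nat_add_iff 1).1 ho
  have h3 : ∑' k : ℕ, q ^ (2 * k) / qPoch (-q) q (2 * k) = 1 + ∑' k, d (2 * k + 1) := by
    rw [hK.tsum_eq_zero_add]
    congr 1
    simp [qPoch_zero]
  rw [h2.tsum_eq, h3]
  linear_combination h1

/-- The bound D does not depend on N, so the remainder of the iterated recurrence tends to 0. -/
lemma summable_even_lambert {p t : ℂ} (hp : ‖p‖ < 1) (ht : ∀ i : ℕ, 1 - p ^ i * t ≠ 0) :
    ∃ D : ℝ, ∀ N : ℕ, HasSum (fun k : ℕ => p ^ k / (qPoch t p (N + k) * qPoch (-p) p k))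
      (∑' k : ℕ, p ^ k / (qPoch t p (N + k) * qPoch (-p) p k)) ∧
      ‖∑' k : ℕ, p ^ k / (qPoch t p (N + k) * qPoch (-p) p k)‖ ≤ D := by
  obtain ⟨C, hC0, hC⟩ := exists_bound_inv_qPoch hp ht
  obtain ⟨C', hC'0, hC'⟩ := exists_bound_inv_qPoch hp (one_sub_pow_mul_neg_ne_zero hp)
  have hg := (summable_geometric_of_lt_one (norm_nonneg _) hp).mul_right (C * C')
  have hb (N k : ℕ) : ‖p ^ k / (qPoch t p (N + k) * qPoch (-p) p k)‖ ≤ ‖p‖ ^ k * (C * C') := by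
    rw [div_eq_mul_inv, norm_mul, norm_pow, mul_inv, norm_mul]
    gcongr
    · exact hC _
    · exact hC' _
  exact ⟨_, fun N => ⟨(Summable.of_norm_bounded hg (hb N)).hasSum,
    tsum_of_norm_bounded hg.hasSum (hb N)⟩⟩

/-- The termwise difference telescopes with u_k = (1 + p^k) / ((t)_(N+k) (-p)_k). The numerator is
chosen so that (1 + p^(k+1)) / (-p)_(k+1) = 1/(-p)_k. It also explains the 2: u_0 = 2/(t)_N. -/
lemma even_lambert_step {p t : ℂ} (hp : ‖p‖ < 1) (ht : ∀ i : ℕ, 1 - p ^ i * t ≠ 0) (N : ℕ) :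
    ∑' k : ℕ, p ^ k / (qPoch t p (N + k) * qPoch (-p) p k) =
      2 * (qPoch t p N)⁻¹ - (qPochInf t p * qPochInf (-p) p)⁻¹ +
        t * p ^ N * ∑' k : ℕ, p ^ k / (qPoch t p (N + 1 + k) * qPoch (-p) p k) := by
  obtain ⟨D, hD⟩ := summable_even_lambert hp ht
  have hs := one_sub_pow_mul_neg_ne_zero hp
  set u : ℕ → ℂ := fun k => (1 + p ^ k) * (qPoch t p (k + N) * qPoch (-p) p k)⁻¹ with hu
  have h1 := (hD N).1.sub ((hD (N + 1)).1.mul_left (t * p ^ N))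
  have h2 : (fun k : ℕ => p ^ k / (qPoch t p (N + k) * qPoch (-p) p k) - t * p ^ N *
      (p ^ k / (qPoch t p (N + 1 + k) * qPoch (-p) p k))) = fun k => u k - u (k + 1) := by
    ext k
    have a1 := qPoch_ne_zero ht (N + k)
    have a2 := qPoch_ne_zero hs k
    have a3 : 1 - t * p ^ (N + k) ≠ 0 := by rw [mul_comm]; exact ht (N + k)
    have a4 : 1 + p ^ (k + 1) ≠ 0 := by
      have := hs k
      rwa [mul_neg, sub_neg_eq_add, ← pow_succ] at this
    simp only [hu]
    rw [show N + 1 + k = N + k + 1 by ring, show k + N = N + k by ring,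
      show k + 1 + N = N + k + 1 by ring, qPoch_succ, qPoch_succ (-p), mul_comm (p ^ (N + k)) t,
      show 1 - p ^ k * -p = 1 + p ^ (k + 1) by ring, mul_inv (_ * _) (qPoch (-p) p k * _),
      mul_inv (qPoch (-p) p k), show ∀ x y z w : ℂ, x * (y * (z * w)) = y * z * (x * w) by
        intros; ring, mul_inv_cancel₀ a4, mul_one]
    have a5 := mul_inv_cancel₀ a3
    simp only [div_eq_mul_inv, mul_inv]
    rw [pow_add] at a5 ⊢
    linear_combination ((qPoch t p (N + k))⁻¹ * (qPoch (-p) p k)⁻¹) * a5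
  have hut : Tendsto u atTop (𝓝 ((1 + 0) * (qPochInf t p * qPochInf (-p) p)⁻¹)) := by
    refine ((tendsto_pow_atTop_nhds_zero_of_norm_lt_one hp).const_add 1).mul
      (Tendsto.inv₀ ?_ (mul_ne_zero (qPochInf_ne_zero hp ht) (qPochInf_ne_zero hp hs)))
    exact ((tendsto_qPoch t hp).comp (tendsto_add_atTop_nat N)).mul (tendsto_qPoch (-p) hp)
  rw [h2] at h1
  have h3 := h1.unique (hasSum_telescope h1.summable hut)
  simp only [hu, qPoch_zero, zero_add, pow_zero, mul_one] at h3
  linear_combination h3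

lemma hasSum_even_lambert {p t : ℂ} (hp : ‖p‖ < 1) (ht : ∀ i : ℕ, 1 - p ^ i * t ≠ 0) :
    HasSum (fun N : ℕ => t ^ N * p ^ N.choose 2 *
        (2 * (qPoch t p N)⁻¹ - (qPochInf t p * qPochInf (-p) p)⁻¹))
      (∑' k : ℕ, p ^ k / (qPoch t p k * qPoch (-p) p k)) := by
  obtain ⟨D, hD⟩ := summable_even_lambert hp ht
  obtain ⟨C, hC0, hC⟩ := exists_bound_inv_qPoch hp ht
  have hsum := summable_pow_mul_pow_choose_two t hp
  have hs : Summable fun N : ℕ => t ^ N * p ^ N.choose 2 *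
      (2 * (qPoch t p N)⁻¹ - (qPochInf t p * qPochInf (-p) p)⁻¹) := by
    refine Summable.of_norm_bounded
      (hsum.mul_right (2 * C + ‖(qPochInf t p * qPochInf (-p) p)⁻¹‖)) fun N => ?_
    rw [norm_mul]
    refine mul_le_mul_of_nonneg_left ((norm_sub_le _ _).trans ?_) (norm_nonneg _)
    rw [norm_mul]
    gcongr
    · simp
    · exact hC N
  have hpart (M : ℕ) : ∑' k : ℕ, p ^ k / (qPoch t p k * qPoch (-p) p k) =
      ∑ N ∈ Finset.range M, t ^ N * p ^ N.choose 2 *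
        (2 * (qPoch t p N)⁻¹ - (qPochInf t p * qPochInf (-p) p)⁻¹) +
      t ^ M * p ^ M.choose 2 *
        ∑' k : ℕ, p ^ k / (qPoch t p (M + k) * qPoch (-p) p k) := by
    induction M with
    | zero => simp
    | succ M ih =>
      rw [ih, Finset.sum_range_succ, even_lambert_step hp ht M, choose_two_succ]
      ring
  have hr : Tendsto (fun M : ℕ => t ^ M * p ^ M.choose 2 *
        ∑' k : ℕ, p ^ k / (qPoch t p (M + k) * qPoch (-p) p k)) atTop (𝓝 0) := by
    have h0 : Tendsto (fun M : ℕ => ‖t ^ M * p ^ M.choose 2‖ * D) atTop (𝓝 0) := by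
      simpa using hsum.tendsto_atTop_zero.mul_const D
    refine squeeze_zero_norm (fun M => ?_) h0
    rw [norm_mul]
    exact mul_le_mul_of_nonneg_left (hD M).2 (norm_nonneg _)
  have h := tendsto_nhds_unique (tendsto_const_nhds.congr hpart) (hs.hasSum.tendsto_sum_nat.add hr)
  rw [h, add_zero]
  exact hs.hasSum

/-- The exponents 1, 5, 9, … and 3, 7, 11, … interlace to all odd numbers. -/
lemma qPoch_mul_qPoch_odd {q : ℂ} (hq0 : q ≠ 0) (n : ℕ) :
    qPoch (-q) (q ^ 4) (n + 1) * qPoch (q ^ 4 / -q) (q ^ 4) n = qPoch (-q) (q ^ 2) (2 * n + 1) := by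
  induction n with
  | zero => simp [qPoch]
  | succ n ih =>
    rw [qPoch_succ _ _ (n + 1), qPoch_succ (q ^ 4 / -q),
      show 2 * (n + 1) + 1 = 2 * n + 1 + 1 + 1 by ring,
      qPoch_succ _ _ (2 * n + 1 + 1), qPoch_succ _ _ (2 * n + 1), ← ih]
    have : q ^ 4 / -q = -q ^ 3 := by field_simp
    rw [this]
    ring

lemma one_sub_sq_pow_mul_neg_ne_zero {q : ℂ} (hq : ‖q‖ < 1) (i : ℕ) :
    1 - (q ^ 2) ^ i * -q ≠ 0 :=
  one_sub_pow_mul_ne_zero (norm_sq_lt_one hq) (by rwa [norm_neg]) i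

/-- The ratio of the two summands is -q^(4n+1)/(1 + q^(4n+1)), so their sum is the first one divided
by 1 + q^(4n+1). -/
lemma gTerm_neg_eq {q : ℂ} (hq0 : q ≠ 0) (hq : ‖q‖ < 1) (n : ℕ) :
    gTerm (-q) (q ^ 4) n =
      (-q) ^ (2 * n) * (q ^ 2) ^ (2 * n).choose 2 * (qPoch (-q) (q ^ 2) (2 * n))⁻¹ +
      (-q) ^ (2 * n + 1) * (q ^ 2) ^ (2 * n + 1).choose 2 *
        (qPoch (-q) (q ^ 2) (2 * n + 1))⁻¹ := by
  have h1 := qPoch_ne_zero (one_sub_sq_pow_mul_neg_ne_zero hq) (2 * n)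
  have h2 := one_sub_sq_pow_mul_neg_ne_zero hq (2 * n)
  have h3 : (q ^ 4) ^ n ^ 2 = (-q) ^ (2 * n) * (q ^ 2) ^ (2 * n).choose 2 := by
    rw [pow_mul (-q), neg_sq, ← pow_mul, ← pow_mul, ← pow_mul, ← pow_add,
      show 4 * n ^ 2 = (2 * n) ^ 2 by ring, ← two_mul_choose_two_add (2 * n), add_comm]
  rw [gTerm, qPoch_mul_qPoch_odd hq0, h3, qPoch_succ, choose_two_succ, pow_succ (-q),
    pow_add (q ^ 2)]
  generalize (-q) ^ (2 * n) = a at *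
  generalize (q ^ 2) ^ (2 * n) = b at *
  generalize (q ^ 2) ^ (2 * n).choose 2 = c at *
  generalize qPoch (-q) (q ^ 2) (2 * n) = d at *
  rw [mul_inv, div_eq_mul_inv, mul_inv]
  have h4 : (1 - b * -q) * (1 - b * -q)⁻¹ = 1 := mul_inv_cancel₀ h2
  linear_combination (a * c * d⁻¹) * h4

/-- The terms are (-1)^n q^(n^2), even in n, so the sum over n ≥ 0 is half of the bilateral sum plus
half of the central term. -/
lemma hasSum_half_theta {q : ℂ} (hq0 : q ≠ 0) (hq : ‖q‖ < 1) :
    HasSum (fun n : ℕ => (-q) ^ n * (q ^ 2) ^ n.choose 2) ((theta q (q ^ 2) + 1) / 2) := by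
  have hq2 : q ^ 2 ≠ 0 := pow_ne_zero _ hq0
  have hs := (summable_pow_mul_pow_choose_two (-q) (norm_sq_lt_one hq)).of_norm
  have hcoe (n : ℕ) : thetaCoeff (q ^ 2) n * q ^ (n : ℤ) = (-q) ^ n * (q ^ 2) ^ n.choose 2 := by
    have : (n : ℤ) * (n - 1) / 2 = n.choose 2 := by
      have := two_mul_choose_two_add n
      have h : (n : ℤ) * (n - 1) = 2 * n.choose 2 := by
        zify at this; linear_combination -this
      rw [h]; simp
    rw [thetaCoeff, this]
    simp only [zpow_natCast]
    rw [neg_pow q]; ring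
  have h1 : HasSum (fun n : ℕ => thetaCoeff (q ^ 2) n * q ^ (n : ℤ)) _ :=
    (by simpa only [hcoe] using hs : Summable _).hasSum
  have h2 : HasSum (fun n : ℕ => thetaCoeff (q ^ 2) (-n) * q ^ (-n : ℤ))
      (∑' n : ℕ, thetaCoeff (q ^ 2) n * q ^ (n : ℤ)) := by
    convert! h1 using 1
    ext n
    have h2 : (q ^ 2) ^ (n : ℤ) = q ^ (n : ℤ) * q ^ (n : ℤ) := by
      simp only [zpow_natCast]; ring
    have h3 := zpow_ne_zero (n : ℤ) hq0
    rw [thetaCoeff_neg hq2, zpow_neg, h2]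
    field_simp
  have h3 := (HasSum.of_nat_of_neg (f := fun k : ℤ => thetaCoeff (q ^ 2) k * q ^ k) h1 h2).unique
    (hasSum_theta hq2 (norm_sq_lt_one hq) hq0)
  simp only [hcoe, thetaCoeff_zero, zpow_zero, mul_one] at h3
  rw [← h3]
  convert! hs.hasSum using 1
  ring

lemma summable_pow_mul_inv_qPoch {q : ℂ} (hq : ‖q‖ < 1) :
    Summable fun N : ℕ => (-q) ^ N * (q ^ 2) ^ N.choose 2 * (qPoch (-q) (q ^ 2) N)⁻¹ := by
  obtain ⟨C, hC0, hC⟩ :=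
    exists_bound_inv_qPoch (norm_sq_lt_one hq) (one_sub_sq_pow_mul_neg_ne_zero hq)
  refine Summable.of_norm_bounded
    ((summable_pow_mul_pow_choose_two (-q) (norm_sq_lt_one hq)).mul_right C) fun N => ?_
  rw [norm_mul]
  exact mul_le_mul_of_nonneg_left (hC N) (norm_nonneg _)

theorem hasSum_gTerm {q : ℂ} (hq0 : q ≠ 0) (hq : ‖q‖ < 1) :
    HasSum (gTerm (-q) (q ^ 4))
      (∑' N : ℕ, (-q) ^ N * (q ^ 2) ^ N.choose 2 * (qPoch (-q) (q ^ 2) N)⁻¹) := by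
  have hs := summable_pow_mul_inv_qPoch hq
  have hg := gTerm_neg_eq hq0 hq
  generalize hA : (fun N : ℕ => (-q) ^ N * (q ^ 2) ^ N.choose 2 * (qPoch (-q) (q ^ 2) N)⁻¹) = A
    at hs ⊢
  have hg' : gTerm (-q) (q ^ 4) = fun n => A (2 * n) + A (2 * n + 1) := by
    rw [← hA]; exact funext hg
  have he : Summable fun k => A (2 * k) := hs.comp_injective fun a b h => by simpa using h
  have ho : Summable fun k => A (2 * k + 1) := hs.comp_injective fun a b h => by simpa using h
  have h := he.hasSum.even_add_odd ho.hasSum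
  rw [h.tsum_eq, hg']
  exact he.hasSum.add ho.hasSum

theorem alternating_fine_eq_gTerm {q : ℂ} (hq0 : q ≠ 0) (hq : ‖q‖ < 1) :
    1 + ∑' m : ℕ, (-1) ^ m * q ^ (m + 1) / qPoch (-q) q (m + 1) =
      4 - 4 * ∑' n, gTerm (-q) (q ^ 4) n + (qPochInf (-q) q)⁻¹ * theta q (q ^ 2) := by
  have hprod : qPochInf (-q) q = qPochInf (-q) (q ^ 2) * qPochInf (-q ^ 2) (q ^ 2) := by
    rw [qPochInf_mul_split (-q) hq two_ne_zero, Finset.prod_range_succ, Finset.prod_range_one]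
    congr 2 <;> ring
  have hK : ∑' k : ℕ, q ^ (2 * k) / qPoch (-q) q (2 * k) =
      ∑' k : ℕ, (q ^ 2) ^ k / (qPoch (-q) (q ^ 2) k * qPoch (-q ^ 2) (q ^ 2) k) := by
    refine tsum_congr fun k => ?_
    rw [pow_mul]
    congr 1
    induction k with
    | zero => simp [qPoch_zero]
    | succ k ih =>
      rw [show 2 * (k + 1) = 2 * k + 1 + 1 by ring, qPoch_succ, qPoch_succ, ih, qPoch_succ,
        qPoch_succ (-q ^ 2)]
      ring
  have h1 := hasSum_even_lambert (norm_sq_lt_one hq) (one_sub_sq_pow_mul_neg_ne_zero hq)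
  have h2 := ((summable_pow_mul_inv_qPoch hq).hasSum.mul_left 2).sub
    ((hasSum_half_theta hq0 hq).mul_right (qPochInf (-q) q)⁻¹)
  have h3 := h1.unique (h2.congr_fun fun N => by rw [hprod]; ring)
  rw [alternating_fine_eq hq, hK, h3, (hasSum_gTerm hq0 hq).tsum_eq]
  ring

/-! ### The Appell–Lerch sum `m(x, q, -1)` -/

/-- The shear `(N, s) ↦ (N - s, s)` of `ℤ × ℤ`. -/
def shearEquiv : ℤ × ℤ ≃ ℤ × ℤ where
  toFun p := (p.1 - p.2, p.2)
  invFun p := (p.1 + p.2, p.2)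
  left_inv p := by simp
  right_inv p := by simp

lemma hasSum_convolution {f g : ℤ → ℂ} (hf : Summable fun k => ‖f k‖)
    (hg : Summable fun k => ‖g k‖) :
    HasSum (fun N => ∑' s, f (N - s) * g s) ((∑' k, f k) * ∑' k, g k) := by
  have h := summable_mul_of_summable_norm hf hg
  have h1 := shearEquiv.hasSum_iff.2 h.hasSum
  rw [tsum_mul_tsum_of_summable_norm hf hg]
  exact h1.prod_fiberwise fun N => (h1.summable.prod_factor N).hasSum

/-- Quasi-periodicity, from shifting the summation index in the triple product by m. -/
lemma theta_zpow_mul {q x : ℂ} (hq0 : q ≠ 0) (hq : ‖q‖ < 1) (hx : x ≠ 0) (m : ℤ) :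
    theta (q ^ m * x) q = (thetaCoeff q m)⁻¹ * x ^ (-m) * theta x q := by
  have h1 := hasSum_theta hq0 hq (mul_ne_zero (zpow_ne_zero m hq0) hx)
  have h2 := ((Equiv.addRight m).hasSum_iff.2 (hasSum_theta hq0 hq hx)).mul_left
    ((thetaCoeff q m)⁻¹ * x ^ (-m))
  refine h1.unique (h2.congr_fun fun k => ?_)
  have h3 := thetaCoeff_ne_zero hq0 m
  have h4 := zpow_ne_zero m hx
  simp only [Function.comp, Equiv.coe_addRight]
  rw [thetaCoeff_add hq0, mul_zpow, ← zpow_mul, zpow_add₀ hx, zpow_neg, mul_comm m k]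
  field_simp

lemma thetaCoeff_mul_self {q : ℂ} (hq0 : q ≠ 0) (k : ℤ) :
    thetaCoeff q k * thetaCoeff q k = q ^ (k * k - k) := by
  have h := thetaCoeff_add hq0 k (-k)
  rw [add_neg_cancel, thetaCoeff_zero, thetaCoeff_neg hq0, mul_neg, zpow_neg] at h
  have h1 := zpow_ne_zero (k * k) hq0
  have h2 := zpow_ne_zero k hq0
  rw [zpow_sub₀ hq0]
  field_simp at h ⊢
  linear_combination -h

lemma theta_one {q : ℂ} (hq : ‖q‖ < 1) : theta 1 q = 0 := by
  have h : qPochInf 1 q = 0 := by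
    rw [qPochInf_eq_mul 1 hq 1]; simp [qPoch]
  rw [theta, h, zero_mul, zero_mul]

/-! ### The Appell–Lerch sum as a double series -/

lemma summable_pow_natAbs {r : ℝ} (h0 : 0 ≤ r) (h1 : r < 1) :
    Summable fun k : ℤ => r ^ k.natAbs := by
  have h := summable_geometric_of_lt_one h0 h1
  exact Summable.of_nat_of_neg (by simpa using h) (by simpa using h)

lemma hasSum_int_geometric {y : ℂ} (hy : ‖y‖ < 1) :
    HasSum (fun d : ℤ => if 0 ≤ d then y ^ d else 0) (1 - y)⁻¹ := by
  have hi : Function.Injective ((↑) : ℕ → ℤ) := Nat.cast_injective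
  refine (hi.hasSum_iff fun d hd => ?_).1 (by
    simpa [Function.comp_def] using hasSum_geometric_of_norm_lt_one hy)
  rw [if_neg]
  exact fun h => hd ⟨d.toNat, by simp [h]⟩

lemma hasSum_int_geometric_neg {y : ℂ} (hy : 1 < ‖y‖) :
    HasSum (fun d : ℤ => if 0 ≤ d then 0 else -y ^ d) (1 - y)⁻¹ := by
  have hy0 : y ≠ 0 := norm_pos_iff.1 (one_pos.trans hy)
  have hi : Function.Injective (fun n : ℕ => -(n : ℤ) - 1) := fun a b h => by simpa using h
  refine (hi.hasSum_iff fun d hd => ?_).1 ?_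
  · rw [if_pos]
    by_contra h
    exact hd ⟨(-d - 1).toNat, by simp only; omega⟩
  · have h1 : ‖y⁻¹‖ < 1 := by rw [norm_inv]; exact inv_lt_one_of_one_lt₀ hy
    convert! (hasSum_geometric_of_norm_lt_one h1).mul_left (-y⁻¹) using 1
    · ext n
      have : ¬ (0 ≤ -(n : ℤ) - 1) := by omega
      simp only [Function.comp, if_neg this]
      rw [zpow_sub_one₀ hy0, zpow_neg, zpow_natCast, inv_pow]
      ring
    · have h2 : 1 - y ≠ 0 := fun h => by
        rw [← sub_eq_zero.1 h, norm_one] at hy; exact lt_irrefl _ hy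
      have h3 : y - 1 ≠ 0 := fun h => h2 (by linear_combination -h)
      rw [show 1 - y⁻¹ = (y - 1) * y⁻¹ by field_simp, mul_inv, inv_inv,
        show -y⁻¹ * ((y - 1)⁻¹ * y) = -(y - 1)⁻¹ * (y⁻¹ * y) by ring, inv_mul_cancel₀ hy0, mul_one,
        ← inv_neg, neg_sub]

/-- The sign in the expansion of the Appell–Lerch sum as a double series. -/
def appellSign (r d : ℤ) : ℂ := (if 0 ≤ d then 1 else 0) - (if r ≤ 0 then 1 else 0)

section
variable {q x z : ℂ}

/-- In the annulus |q| < |xz| < 1 the ratio q^(r-1)xz is inside the unit disc for r ≥ 1 and outside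
it for r ≤ 0. The two geometric expansions differ only in which d occur and with which sign. -/
lemma hasSum_appellSign (hq0 : q ≠ 0) (hq : ‖q‖ < 1) (h1 : ‖q‖ < ‖x * z‖) (h2 : ‖x * z‖ < 1)
    (r : ℤ) :
    HasSum (fun d : ℤ => appellSign r d * (q ^ (r - 1) * (x * z)) ^ d)
      (1 - q ^ (r - 1) * (x * z))⁻¹ := by
  have hn : 0 < ‖q‖ := norm_pos_iff.2 hq0
  rcases le_or_gt r 0 with hr | hr
  · refine (hasSum_int_geometric_neg ?_).congr_fun fun d => ?_
    · rw [norm_mul, norm_zpow]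
      have : ‖q‖⁻¹ ≤ ‖q‖ ^ (r - 1) := by
        rw [← zpow_neg_one]
        exact zpow_le_zpow_right_of_le_one₀ hn hq.le (by omega)
      calc (1 : ℝ) = ‖q‖⁻¹ * ‖q‖ := (inv_mul_cancel₀ hn.ne').symm
        _ < ‖q‖⁻¹ * ‖x * z‖ := by gcongr
        _ ≤ _ := by gcongr
    · rw [appellSign, if_pos hr]; split_ifs <;> simp
  · refine (hasSum_int_geometric ?_).congr_fun fun d => ?_
    · rw [norm_mul, norm_zpow]
      exact mul_lt_one_of_nonneg_of_lt_one_right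
        (zpow_le_one₀ hn hq.le (by omega)) (norm_nonneg _) h2
    · rw [appellSign, if_neg hr.not_ge]; split_ifs <;> simp

lemma norm_appellSign_mul_le (hq0 : q ≠ 0) (hq : ‖q‖ < 1) (h1 : ‖q‖ < ‖x * z‖) (r d : ℤ) :
    ‖appellSign r d * (q ^ (r - 1) * (x * z)) ^ d‖ ≤
      max ‖x * z‖ (‖q‖ / ‖x * z‖) ^ d.natAbs := by
  have hn : 0 < ‖q‖ := norm_pos_iff.2 hq0
  have hp : 0 < ‖x * z‖ := hn.trans h1
  rcases le_or_gt r 0 with hr | hr <;> rcases le_or_gt 0 d with hd | hd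
  · simp only [appellSign, if_pos hr, if_pos hd, sub_self, zero_mul, norm_zero]
    positivity
  · obtain ⟨n, rfl⟩ : ∃ n : ℕ, d = -n := ⟨d.natAbs, by omega⟩
    have h3 : ‖q‖⁻¹ ≤ ‖q‖ ^ (r - 1) := by
      rw [← zpow_neg_one]
      exact zpow_le_zpow_right_of_le_one₀ hn hq.le (by omega)
    have h4 : (‖q‖ ^ (r - 1) * ‖x * z‖)⁻¹ ≤ ‖q‖ / ‖x * z‖ := by
      calc _ ≤ (‖q‖⁻¹ * ‖x * z‖)⁻¹ := by gcongr
        _ = _ := by rw [mul_inv, inv_inv, div_eq_mul_inv]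
    rw [appellSign, if_pos hr, if_neg hd.not_ge, zero_sub, norm_mul, norm_neg, norm_one, one_mul,
      norm_zpow, norm_mul, norm_zpow, zpow_neg, ← inv_zpow, zpow_natCast, Int.natAbs_neg,
      Int.natAbs_natCast]
    exact pow_le_pow_left₀ (by positivity) (h4.trans (le_max_right _ _)) n
  · obtain ⟨n, rfl⟩ : ∃ n : ℕ, d = n := ⟨d.natAbs, by omega⟩
    rw [appellSign, if_neg hr.not_ge, if_pos hd, sub_zero, one_mul, norm_zpow, zpow_natCast,
      Int.natAbs_natCast, norm_mul, norm_zpow]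
    refine pow_le_pow_left₀ (by positivity) (le_trans ?_ (le_max_left _ _)) n
    exact mul_le_of_le_one_left (norm_nonneg _) (zpow_le_one₀ hn hq.le (by omega))
  · simp only [appellSign, if_neg hr.not_ge, if_neg hd.not_ge, sub_self, zero_mul, norm_zero]
    positivity

lemma appellTerm_eq (q x z : ℂ) (r : ℤ) :
    appellTerm x q z r = thetaCoeff q r * z ^ r * (1 - q ^ (r - 1) * (x * z))⁻¹ := by
  rw [appellTerm, thetaCoeff, div_eq_mul_inv, mul_assoc (q ^ (r - 1))]

lemma summable_appell_double (hq0 : q ≠ 0) (hq : ‖q‖ < 1) (hz : z ≠ 0) (h1 : ‖q‖ < ‖x * z‖)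
    (h2 : ‖x * z‖ < 1) :
    Summable fun p : ℤ × ℤ => thetaCoeff q p.1 * z ^ p.1 *
      (appellSign p.1 p.2 * (q ^ (p.1 - 1) * (x * z)) ^ p.2) := by
  have hn : 0 < ‖q‖ := norm_pos_iff.2 hq0
  have hρ : max ‖x * z‖ (‖q‖ / ‖x * z‖) < 1 := max_lt h2 ((div_lt_one (hn.trans h1)).2 h1)
  have hρ0 : 0 ≤ max ‖x * z‖ (‖q‖ / ‖x * z‖) := le_max_of_le_left (norm_nonneg _)
  refine Summable.of_norm_bounded ((summable_thetaCoeff hq0 hq hz).mul_of_nonneg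
    (summable_pow_natAbs hρ0 hρ) (fun _ => norm_nonneg _) (fun _ => by positivity)) fun p => ?_
  rw [norm_mul]
  exact mul_le_mul_of_nonneg_left (norm_appellSign_mul_le hq0 hq h1 _ _) (norm_nonneg _)

lemma hasSum_appell_double (hq0 : q ≠ 0) (hq : ‖q‖ < 1) (hz : z ≠ 0) (h1 : ‖q‖ < ‖x * z‖)
    (h2 : ‖x * z‖ < 1) :
    HasSum (appellTerm x q z) (∑' p : ℤ × ℤ, thetaCoeff q p.1 * z ^ p.1 *
      (appellSign p.1 p.2 * (q ^ (p.1 - 1) * (x * z)) ^ p.2)) := by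
  have h := (summable_appell_double hq0 hq hz h1 h2).hasSum.prod_fiberwise
    (g := fun r => thetaCoeff q r * z ^ r * (1 - q ^ (r - 1) * (x * z))⁻¹)
    fun r => (hasSum_appellSign hq0 hq h1 h2 r).mul_left (thetaCoeff q r * z ^ r)
  exact h.congr_fun (appellTerm_eq q x z)

/-- The term of index `s` in the coefficient of `z ^ N` (up to the factor `thetaCoeff q N`) in the
product of `j(z; q)` and the Lambert series `∑_{s ≠ 0} (x z) ^ s / (1 - q ^ s)`. -/
noncomputable def thetaLambertTerm (x q : ℂ) (N s : ℤ) : ℂ :=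
  thetaCoeff q s * (q ^ (1 - N) * x) ^ s * (1 - q ^ s)⁻¹

lemma summable_thetaLambertTerm (hq0 : q ≠ 0) (hq : ‖q‖ < 1) (hx : x ≠ 0) (N : ℤ) :
    Summable (thetaLambertTerm x q N) := by
  obtain ⟨C, hC0, hC⟩ := exists_bound_inv_one_sub_zpow hq0 hq one_ne_zero
  refine Summable.of_norm_bounded ((summable_thetaCoeff hq0 hq
    (mul_ne_zero (zpow_ne_zero (1 - N) hq0) hx)).mul_right C) fun s => ?_
  rw [thetaLambertTerm, norm_mul]
  refine mul_le_mul_of_nonneg_left ?_ (norm_nonneg _)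
  simpa using hC s

lemma one_sub_zpow_ne_zero (hq : ‖q‖ < 1) {s : ℤ} (hs : s ≠ 0) : 1 - q ^ s ≠ 0 := by
  intro h
  have h1 : ‖q‖ ^ s = 1 := by rw [← norm_zpow, ← sub_eq_zero.1 h, norm_one]
  exact hs ((zpow_eq_one_iff_right₀ (norm_nonneg _) hq.ne).1 h1)

/-- Raising N by one multiplies the term s by q^(-s), so the difference cancels 1 - q^s. What
remains is the theta series at q^(-N)x without its term s = 0, whence the -1. -/
lemma tsum_thetaLambertTerm_succ (hq0 : q ≠ 0) (hq : ‖q‖ < 1) (hx : x ≠ 0) (N : ℤ) :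
    ∑' s, thetaLambertTerm x q (N + 1) s - ∑' s, thetaLambertTerm x q N s =
      (thetaCoeff q (-N))⁻¹ * x ^ N * theta x q - 1 := by
  have h1 := (summable_thetaLambertTerm hq0 hq hx (N + 1)).hasSum.sub
    (summable_thetaLambertTerm hq0 hq hx N).hasSum
  have h2 := (hasSum_theta hq0 hq (mul_ne_zero (zpow_ne_zero (-N) hq0) hx)).sub
    (hasSum_ite_eq (0 : ℤ) (1 : ℂ))
  rw [theta_zpow_mul hq0 hq hx, neg_neg] at h2
  refine h1.unique (h2.congr_fun fun s => ?_)
  split_ifs with hs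
  · simp [hs, thetaLambertTerm, thetaCoeff_zero]
  · have h3 := one_sub_zpow_ne_zero hq hs
    have h4 : q ^ s ≠ 0 := zpow_ne_zero _ hq0
    rw [thetaLambertTerm, thetaLambertTerm, show 1 - (N + 1) = -N by ring,
      show 1 - N = -N + 1 by ring, zpow_add_one₀ hq0, mul_right_comm _ q x, mul_zpow _ q s]
    field_simp
    ring

/-- Both sides vanish at N = 0. Passing to N + 1 changes the sign only at d = N, and that single
term is the increment of the Lambert terms plus 1. The accumulated ones form the summand N. -/
lemma hasSum_appell_coeff (hq0 : q ≠ 0) (hq : ‖q‖ < 1) (hx : x ≠ 0) (N : ℤ) :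
    HasSum (fun d => theta x q * ((thetaCoeff q (-d))⁻¹ * x ^ d * appellSign (N - d) d))
      (∑' s, thetaLambertTerm x q N s - ∑' s, thetaLambertTerm x q 0 s + N) := by
  have key (N d : ℤ) : theta x q * ((thetaCoeff q (-d))⁻¹ * x ^ d * appellSign (N + 1 - d) d) -
      theta x q * ((thetaCoeff q (-d))⁻¹ * x ^ d * appellSign (N - d) d) =
      if d = N then theta x q * ((thetaCoeff q (-N))⁻¹ * x ^ N) else 0 := by
    rw [← mul_sub, ← mul_sub]
    have : appellSign (N + 1 - d) d - appellSign (N - d) d = if d = N then 1 else 0 := by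
      simp only [appellSign]
      split_ifs <;> first | omega | simp
    rw [this]
    split_ifs with h
    · rw [h, mul_one]
    · simp
  induction N using Int.induction_on with
  | zero =>
    convert! hasSum_zero using 1
    · ext d
      have : appellSign (0 - d) d = 0 := by
        simp only [appellSign]
        split_ifs <;> first | omega | simp
      rw [this, mul_zero, mul_zero]
    · simp
  | succ N ih =>
    have h := ih.add (hasSum_ite_eq (N : ℤ) (theta x q * ((thetaCoeff q (-N))⁻¹ * x ^ (N : ℤ))))
    convert! h using 1
    · ext d; rw [← key]; ring
    · push_cast
      linear_combination tsum_thetaLambertTerm_succ hq0 hq hx N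
  | pred N ih =>
    have h := ih.sub (hasSum_ite_eq (-N - 1 : ℤ)
      (theta x q * ((thetaCoeff q (-(-N - 1)))⁻¹ * x ^ (-N - 1 : ℤ))))
    convert! h using 1
    · ext d; rw [← key, sub_add_cancel]; ring
    · have := tsum_thetaLambertTerm_succ hq0 hq hx (-N - 1)
      rw [sub_add_cancel] at this
      push_cast
      linear_combination -this

/-- The Lambert series `∑_{s ≠ 0} y ^ s / (1 - q ^ s)` converges for `‖q‖ < ‖y‖ < 1`. The term with
`s = 0` is `0`. -/
lemma summable_int_lambert {y : ℂ} (hq0 : q ≠ 0) (hq : ‖q‖ < 1) (h1 : ‖q‖ < ‖y‖) (h2 : ‖y‖ < 1) :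
    Summable fun s : ℤ => ‖y ^ s * (1 - q ^ s)⁻¹‖ := by
  have hn : 0 < ‖q‖ := norm_pos_iff.2 hq0
  have hy : 0 < ‖y‖ := hn.trans h1
  have hc (n : ℕ) : ‖(1 - q ^ (n + 1))⁻¹‖ ≤ (1 - ‖q‖)⁻¹ := by
    rw [norm_inv]
    refine inv_anti₀ (by linarith) ?_
    have h3 := norm_sub_norm_le (1 : ℂ) (q ^ (n + 1))
    rw [norm_one, norm_pow] at h3
    have h4 : ‖q‖ ^ (n + 1) ≤ ‖q‖ := pow_le_of_le_one hn.le hq.le (by omega)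
    linarith
  refine Summable.of_nat_of_neg ((summable_nat_add_iff 1).1 ?_) ((summable_nat_add_iff 1).1 ?_)
  · refine Summable.of_nonneg_of_le (fun _ => norm_nonneg _) (fun n => ?_)
      (((summable_nat_add_iff 1).2 (summable_geometric_of_lt_one hy.le h2)).mul_right (1 - ‖q‖)⁻¹)
    rw [zpow_natCast, zpow_natCast, norm_mul, norm_pow]
    gcongr
    exact hc n
  · refine Summable.of_nonneg_of_le (fun _ => norm_nonneg _) (fun n => ?_)
      (((summable_nat_add_iff 1).2 (summable_geometric_of_lt_one (r := ‖q‖ / ‖y‖) (by positivity)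
        ((div_lt_one hy).2 h1))).mul_right (1 - ‖q‖)⁻¹)
    have h5 : q ^ (n + 1) ≠ 0 := pow_ne_zero _ hq0
    have h6 : (1 - (q ^ (n + 1))⁻¹)⁻¹ = -(q ^ (n + 1) * (1 - q ^ (n + 1))⁻¹) := by
      rw [show 1 - (q ^ (n + 1))⁻¹ = -((q ^ (n + 1))⁻¹ * (1 - q ^ (n + 1))) by field_simp; ring,
        inv_neg, mul_inv, inv_inv]
    rw [zpow_neg, zpow_neg, zpow_natCast, zpow_natCast, h6, mul_neg, norm_neg, ← mul_assoc,
      norm_mul, norm_mul, norm_inv, norm_pow, norm_pow, div_pow, mul_comm (_)⁻¹, ← div_eq_mul_inv]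
    gcongr
    exact hc n

/-- The theta function times an Appell–Lerch sum, in terms of a Lambert series. -/
lemma hasSum_mul_theta_deriv (hq0 : q ≠ 0) (hq : ‖q‖ < 1) (hx : x ≠ 0) (hz : z ≠ 0)
    (h1 : ‖q‖ < ‖x * z‖) (h2 : ‖x * z‖ < 1) :
    HasSum (fun N : ℤ => N * (thetaCoeff q N * z ^ N))
      (theta x q * ∑' r, appellTerm x q z r -
        (theta z q * ∑' s : ℤ, (x * z) ^ s * (1 - q ^ s)⁻¹ -
          theta z q * ∑' s, thetaLambertTerm x q 0 s)) := by
  have hd := (summable_appell_double hq0 hq hz h1 h2).hasSum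
  rw [(hasSum_appell_double hq0 hq hz h1 h2).tsum_eq]
  -- Regrouping the double series along r + d = N collects the factor z^N. Subtracting the
  -- corresponding terms of j(z) times the Lambert series leaves N times the theta term, that is,
  -- the series of z j'(z).
  have a1 := ((shearEquiv.hasSum_iff.2 hd).mul_left (theta x q)).prod_fiberwise
    (g := fun N => thetaCoeff q N * z ^ N *
      (∑' s, thetaLambertTerm x q N s - ∑' s, thetaLambertTerm x q 0 s + N)) fun N => by
    refine ((hasSum_appell_coeff hq0 hq hx N).mul_left (thetaCoeff q N * z ^ N)).congr_fun
      fun d => ?_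
    have e1 := thetaCoeff_add hq0 N (-d)
    have e2 := thetaCoeff_ne_zero hq0 (-d)
    simp only [Function.comp, shearEquiv, Equiv.coe_fn_mk]
    rw [sub_eq_add_neg N d, e1, mul_zpow, mul_zpow, ← zpow_mul,
      show (N + -d - 1) * d = -(N * -d) - (d * d + d) by ring, zpow_sub₀ hq0, zpow_neg,
      zpow_add₀ hz, zpow_neg z]
    have e3 := zpow_ne_zero (N * -d) hq0
    have e4 : thetaCoeff q (-d) * thetaCoeff q (-d) = q ^ (d * d + d) := by
      rw [thetaCoeff_mul_self hq0]; congr 1; ring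
    have e5 := zpow_ne_zero d hz
    rw [← e4]
    field_simp
  have a2 := hasSum_convolution (summable_thetaCoeff hq0 hq hz) (summable_int_lambert hq0 hq h1 h2)
  have a3 (N : ℤ) : ∑' s, thetaCoeff q (N - s) * z ^ (N - s) * ((x * z) ^ s * (1 - q ^ s)⁻¹) =
      thetaCoeff q N * z ^ N * ∑' s, thetaLambertTerm x q N s := by
    rw [← tsum_mul_left]
    refine tsum_congr fun s => ?_
    have e1 := thetaCoeff_add hq0 N (-s)
    have e2 := zpow_ne_zero s hz
    rw [sub_eq_add_neg, e1, thetaLambertTerm, thetaCoeff_neg hq0, mul_zpow, mul_zpow, ← zpow_mul,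
      show (1 - N) * s = s + N * -s by ring, zpow_add₀ hq0, zpow_add₀ hz, zpow_neg z]
    field_simp
  rw [(hasSum_theta hq0 hq hz).tsum_eq] at a2
  simp only [a3] at a2
  refine (a1.sub (a2.sub ((hasSum_theta hq0 hq hz).mul_right
    (∑' s, thetaLambertTerm x q 0 s)))).congr_fun fun N => ?_
  ring

theorem theta_mul_appell_neg_one (hq0 : q ≠ 0) (hx1 : ‖q‖ < ‖x‖) (hx2 : ‖x‖ < 1) :
    theta x q * ∑' r, appellTerm x q (-1) r = theta (-1) q *
      (∑' s : ℤ, (-x) ^ s * (1 - q ^ s)⁻¹ - ∑' s, thetaLambertTerm x q 0 s + 1 / 2) := by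
  have hx : x ≠ 0 := norm_pos_iff.1 ((norm_nonneg _).trans_lt hx1)
  have hq := hx1.trans hx2
  have hz : (-1 : ℂ) ≠ 0 := by norm_num
  have h := hasSum_mul_theta_deriv (z := -1) hq0 hq hx hz (by simpa using hx1) (by simpa using hx2)
  -- At z = -1 the theta term is invariant under N ↦ 1 - N, while the weights N and 1 - N add up to
  -- 1. Hence twice the derivative series is theta itself.
  have hr := (Equiv.subLeft (1 : ℤ)).hasSum_iff.2 h
  have h2 := (h.add hr).unique ((hasSum_theta hq0 hq hz).congr_fun fun N => by
    simp only [Function.comp, Equiv.subLeft_apply]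
    rw [thetaCoeff_one_sub, zpow_sub₀ hz, zpow_one]
    have : (-1 : ℂ) ^ N * (-1) ^ N = 1 := by rw [← mul_zpow]; simp
    have h0 := neg_one_zpow_ne_zero N
    push_cast
    field_simp
    linear_combination (-(1 - N) * thetaCoeff q N) * this)
  rw [mul_neg_one] at h2
  linear_combination h2 / 2


end

/-! ### A Lambert series as a product -/

lemma tendsto_qPochInf_comp {q x : ℂ} (hq : ‖q‖ < 1) {u : ℕ → ℂ}
    (hu : Tendsto u atTop (𝓝 x)) :
    Tendsto (fun n => qPochInf (u n) q) atTop (𝓝 (qPochInf x q)) := by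
  obtain ⟨C, hC⟩ := (Metric.isBounded_range_of_tendsto _ hu).exists_norm_le
  have h := tendsto_tprod_one_add_of_dominated_convergence (𝓕 := atTop)
    (f := fun (n : ℕ) (i : ℕ) => -(q ^ i * u n)) (g := fun i => -(q ^ i * x))
    (bound := fun i => ‖q‖ ^ i * C)
    ((summable_geometric_of_lt_one (norm_nonneg q) hq).mul_right C)
    (fun i => (hu.const_mul _).neg) (Eventually.of_forall fun n i => by
      rw [norm_neg, norm_mul, norm_pow]
      exact mul_le_mul_of_nonneg_left (hC _ ⟨n, rfl⟩) (by positivity))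
  simpa only [qPochInf, sub_eq_add_neg] using h

lemma theta_eq_one_sub_mul (x : ℂ) {q : ℂ} (hq : ‖q‖ < 1) :
    theta x q = (1 - x) * (qPochInf (q * x) q * qPochInf (q / x) q * qPochInf q q) := by
  rw [theta, qPochInf_eq_mul x hq 1]
  simp only [qPoch, Finset.prod_range_one, pow_zero, one_mul, pow_one]
  ring

section
variable {q a b : ℂ}

/-- `1 / (1 - a q ^ s)`, minus its limit `1` at infinity for `s ≥ 0`. -/
noncomputable def poleTerm (a q : ℂ) (s : ℤ) : ℂ := (1 - a * q ^ s)⁻¹ - if 0 ≤ s then 1 else 0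

lemma summable_poleTerm (hq0 : q ≠ 0) (hq : ‖q‖ < 1) (ha0 : a ≠ 0)
    (ha : ∀ k : ℤ, 1 - a * q ^ k ≠ 0) : Summable fun s => ‖poleTerm a q s‖ := by
  obtain ⟨C, hC0, hC⟩ := exists_bound_inv_one_sub_zpow hq0 hq ha0
  obtain ⟨D, hD0, hD⟩ := exists_bound_inv_one_sub_zpow hq0 hq (inv_ne_zero ha0)
  have hg := summable_geometric_of_lt_one (norm_nonneg q) hq
  refine Summable.of_nat_of_neg ?_ ((summable_nat_add_iff 1).1 ?_)
  · refine Summable.of_nonneg_of_le (fun _ => norm_nonneg _) (fun n => ?_)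
      (hg.mul_left (‖a‖ * C))
    have h : poleTerm a q n = a * (1 - a * q ^ (n : ℤ))⁻¹ * q ^ n := by
      have := ha n
      rw [poleTerm, if_pos (by omega)]
      rw [zpow_natCast] at *
      field_simp
      ring
    rw [h, norm_mul, norm_mul, norm_pow]
    gcongr
    exact hC _
  · refine Summable.of_nonneg_of_le (fun _ => norm_nonneg _) (fun n => ?_)
      (((summable_nat_add_iff 1).2 hg).mul_left (‖a⁻¹‖ * D))
    have h : poleTerm a q (-((n + 1 : ℕ) : ℤ)) =
        -(a⁻¹ * (1 - a⁻¹ * q ^ ((n + 1 : ℕ) : ℤ))⁻¹ * q ^ (n + 1)) := by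
      have h1 := ha (-((n + 1 : ℕ) : ℤ))
      have h2 : q ^ (n + 1) ≠ 0 := pow_ne_zero _ hq0
      rw [poleTerm, if_neg (by omega), sub_zero]
      rw [zpow_neg, zpow_natCast] at *
      have h3 : 1 - a⁻¹ * q ^ (n + 1) ≠ 0 := by
        intro h
        apply h1
        field_simp at h ⊢
        linear_combination -h
      rw [inv_eq_iff_eq_inv, inv_neg, mul_inv, mul_inv, inv_inv, inv_inv]
      field_simp
      ring
    rw [h, norm_neg, norm_mul, norm_mul, norm_pow]
    gcongr
    exact hD _

lemma summable_thetaCoeff_mul_pole (hq0 : q ≠ 0) (hq : ‖q‖ < 1) (ha0 : a ≠ 0) (N : ℤ) :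
    Summable fun s : ℤ => thetaCoeff q (N - s) * (1 - a * q ^ s)⁻¹ := by
  obtain ⟨C, hC0, hC⟩ := exists_bound_inv_one_sub_zpow hq0 hq ha0
  have h := (Equiv.subLeft N).summable_iff.2 (summable_thetaCoeff hq0 hq one_ne_zero)
  refine Summable.of_norm_bounded (h.mul_right C) fun s => ?_
  simp only [Function.comp, Equiv.subLeft_apply, one_zpow, mul_one, norm_mul]
  exact mul_le_mul_of_nonneg_left (hC s) (norm_nonneg _)

/-- The combination of coefficients equals -q^(N-s) thetaCoeff(N - s) (1 - aq^s), which cancels the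
pole. What is left is the theta series at 1, which is 0. -/
lemma tsum_thetaCoeff_mul_pole_succ (hq0 : q ≠ 0) (hq : ‖q‖ < 1) (ha0 : a ≠ 0)
    (ha : ∀ k : ℤ, 1 - a * q ^ k ≠ 0) (N : ℤ) :
    ∑' s : ℤ, thetaCoeff q (N + 1 - s) * (1 - a * q ^ s)⁻¹ =
      -(a * q ^ N) * ∑' s : ℤ, thetaCoeff q (N - s) * (1 - a * q ^ s)⁻¹ := by
  have h1 := (summable_thetaCoeff_mul_pole hq0 hq ha0 (N + 1)).hasSum.add
    ((summable_thetaCoeff_mul_pole hq0 hq ha0 N).hasSum.mul_left (a * q ^ N))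
  have h2 := (Equiv.subLeft (N + 1)).hasSum_iff.2 (hasSum_theta hq0 hq one_ne_zero)
  rw [theta_one hq] at h2
  have h3 := h1.unique (h2.congr_fun fun s => ?_)
  · linear_combination h3
  · have h4 := ha s
    have h5 := zpow_ne_zero s hq0
    simp only [Function.comp, Equiv.subLeft_apply, one_zpow, mul_one]
    rw [show N + 1 - s = N - s + 1 by ring, thetaCoeff_succ hq0, zpow_sub₀ hq0]
    have h6 := mul_inv_cancel₀ h4
    have h7 := mul_inv_cancel₀ h5
    rw [div_eq_mul_inv]
    linear_combination (-(q ^ N * (q ^ s)⁻¹ * thetaCoeff q (N - s))) * h6 -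
      (a * q ^ N * thetaCoeff q (N - s) * (1 - a * q ^ s)⁻¹) * h7

lemma tsum_thetaCoeff_mul_pole (hq0 : q ≠ 0) (hq : ‖q‖ < 1) (ha0 : a ≠ 0)
    (ha : ∀ k : ℤ, 1 - a * q ^ k ≠ 0) (N : ℤ) :
    ∑' s : ℤ, thetaCoeff q (N - s) * (1 - a * q ^ s)⁻¹ =
      thetaCoeff q N * a ^ N * ∑' s : ℤ, thetaCoeff q (0 - s) * (1 - a * q ^ s)⁻¹ := by
  induction N using Int.induction_on with
  | zero => simp [thetaCoeff_zero]
  | succ N ih =>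
    rw [tsum_thetaCoeff_mul_pole_succ hq0 hq ha0 ha, ih, thetaCoeff_succ hq0, zpow_add_one₀ ha0]
    ring
  | pred N ih =>
    have h := tsum_thetaCoeff_mul_pole_succ hq0 hq ha0 ha (-N - 1)
    have h1 := thetaCoeff_succ hq0 (-N - 1)
    have h2 := zpow_ne_zero (-N - 1 : ℤ) hq0
    rw [sub_add_cancel] at h h1
    rw [ih, h1, show (-N : ℤ) = -N - 1 + 1 by ring, zpow_add_one₀ ha0] at h
    rw [← sub_eq_zero] at h ⊢
    refine (mul_eq_zero.1 (?_ : (a * q ^ (-N - 1 : ℤ)) * _ = 0)).resolve_left (mul_ne_zero ha0 h2)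
    simp only [add_sub_cancel_right] at h ⊢
    linear_combination h

/-- Multiplying by the theta series in b makes each convolution term a difference of two consecutive
pole sums. These are known up to their value at N = 0, which becomes the constant on the right. -/
lemma theta_mul_poleSeries (hq0 : q ≠ 0) (hq : ‖q‖ < 1) (ha0 : a ≠ 0)
    (ha : ∀ k : ℤ, 1 - a * q ^ k ≠ 0) (hb : ‖b‖ = 1) :
    theta b q * (1 + (1 - b) * ∑' s : ℤ, b ^ s * poleTerm a q s) =
      (1 - b) * (∑' s : ℤ, thetaCoeff q (0 - s) * (1 - a * q ^ s)⁻¹) * theta (a * b) q := by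
  have hb0 : b ≠ 0 := norm_ne_zero_iff.1 (by rw [hb]; exact one_ne_zero)
  have hw := summable_poleTerm hq0 hq ha0 ha
  have hbw : Summable fun s : ℤ => ‖b ^ s * poleTerm a q s‖ := by
    simpa only [norm_mul, norm_zpow, hb, one_zpow, one_mul] using hw
  have hbw1 : Summable fun s : ℤ => ‖b ^ (s - 1) * poleTerm a q (s - 1)‖ :=
    (Equiv.subRight (1 : ℤ)).summable_iff.2 hbw
  -- Summation by parts; the jump at s = 0 of the step function inside `poleTerm` yields the
  -- constant 1.
  have hg (s : ℤ) : b ^ s * ((1 - a * q ^ s)⁻¹ - (1 - a * q ^ (s - 1))⁻¹) =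
      b ^ s * poleTerm a q s - b * (b ^ (s - 1) * poleTerm a q (s - 1)) +
        if s = 0 then 1 else 0 := by
    rw [poleTerm, poleTerm, zpow_sub_one₀ hb0]
    rcases lt_trichotomy s 0 with h | rfl | h
    · rw [if_neg (by omega), if_neg (by omega), if_neg (by omega)]
      field_simp; ring
    · simp
      field_simp; ring
    · rw [if_pos (by omega), if_pos (by omega), if_neg (by omega)]
      field_simp; ring
  have hgs : HasSum (fun s : ℤ => b ^ s * ((1 - a * q ^ s)⁻¹ - (1 - a * q ^ (s - 1))⁻¹))
      (1 + (1 - b) * ∑' s : ℤ, b ^ s * poleTerm a q s) := by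
    have h1 := (Equiv.subRight (1 : ℤ)).hasSum_iff.2 hbw.of_norm.hasSum
    have h2 := (hbw.of_norm.hasSum.sub (h1.mul_left b)).add (hasSum_ite_eq (0 : ℤ) (1 : ℂ))
    convert! h2 using 1
    · ext s; exact hg s
    · ring
  have hgn : Summable fun s : ℤ =>
      ‖b ^ s * ((1 - a * q ^ s)⁻¹ - (1 - a * q ^ (s - 1))⁻¹)‖ := by
    refine Summable.of_nonneg_of_le (fun _ => norm_nonneg _) (fun s => ?_)
      ((hbw.add (hbw1.mul_left ‖b‖)).add (hasSum_ite_eq (0 : ℤ) (1 : ℝ)).summable)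
    rw [hg]
    refine (norm_add_le _ _).trans (add_le_add ((norm_sub_le _ _).trans ?_) ?_)
    · rw [norm_mul b]
    · split_ifs <;> simp
  have hconv := hasSum_convolution (summable_thetaCoeff hq0 hq hb0) hgn
  rw [hgs.tsum_eq, (hasSum_theta hq0 hq hb0).tsum_eq] at hconv
  have hθ := hasSum_theta hq0 hq (mul_ne_zero ha0 hb0)
  have hθ1 := (Equiv.subRight (1 : ℤ)).hasSum_iff.2 hθ
  have h3 := (hθ.sub (hθ1.mul_left b)).mul_right
    (∑' s : ℤ, thetaCoeff q (0 - s) * (1 - a * q ^ s)⁻¹)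
  have h4 := hconv.unique (h3.congr_fun fun N => ?_)
  · rw [h4]; ring
  · simp only [Function.comp, Equiv.subRight_apply]
    have e1 := (summable_thetaCoeff_mul_pole hq0 hq ha0 N).hasSum
    have e2 := (Equiv.subRight (1 : ℤ)).hasSum_iff.2
      (summable_thetaCoeff_mul_pole hq0 hq ha0 (N - 1)).hasSum
    have e3 := ((e1.sub e2).mul_left (b ^ N)).tsum_eq
    rw [tsum_thetaCoeff_mul_pole hq0 hq ha0 ha N,
      tsum_thetaCoeff_mul_pole hq0 hq ha0 ha (N - 1)] at e3
    rw [mul_zpow, mul_zpow, zpow_sub_one₀ hb0]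
    refine Eq.trans (tsum_congr fun s => ?_) (e3.trans ?_)
    · simp only [Function.comp, Equiv.subRight_apply]
      rw [show N - 1 - (s - 1) = N - s by ring, zpow_sub₀ hb0]
      field_simp
    · field_simp

/-- The constant is found by dividing `theta_mul_poleSeries` by 1 - b and letting b → 1 along the
unit circle, where |b^s| = 1 keeps the pole series bounded. -/
lemma tsum_pole_mul_theta (hq0 : q ≠ 0) (hq : ‖q‖ < 1) (ha0 : a ≠ 0)
    (ha : ∀ k : ℤ, 1 - a * q ^ k ≠ 0) :
    (∑' s : ℤ, thetaCoeff q (0 - s) * (1 - a * q ^ s)⁻¹) * theta a q = qPochInf q q ^ 3 := by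
  have hw := summable_poleTerm hq0 hq ha0 ha
  -- Points exp(i/(n+1)) of the unit circle tending to 1. None equals 1, since 0 < 1/(n+1) ≤ 1 < 2π.
  set β : ℕ → ℂ := fun n => Complex.exp (((1 / ((n : ℝ) + 1) : ℝ) : ℂ) * Complex.I) with hβ
  have hβ1 (n : ℕ) : ‖β n‖ = 1 := Complex.norm_exp_ofReal_mul_I _
  have hβ0 (n : ℕ) : β n ≠ 0 := Complex.exp_ne_zero _
  have hβne (n : ℕ) : 1 - β n ≠ 0 := by
    intro h
    have h1 : β n = 1 := by linear_combination -h
    obtain ⟨k, hk⟩ := Complex.exp_eq_one_iff.1 h1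
    have h2 : ((1 / ((n : ℝ) + 1) : ℝ) : ℂ) = ((k * (2 * Real.pi) : ℝ) : ℂ) := by
      have := mul_right_cancel₀ Complex.I_ne_zero
        (show _ * Complex.I = (k * (2 * Real.pi) : ℂ) * Complex.I by rw [hk]; ring)
      rw [this]; push_cast; ring
    have h3 : 1 / ((n : ℝ) + 1) = k * (2 * Real.pi) := by exact_mod_cast h2
    have h4 : 0 < 1 / ((n : ℝ) + 1) := by positivity
    have h5 : 1 / ((n : ℝ) + 1) ≤ 1 := by
      rw [div_le_one (by positivity)]; linarith [Nat.cast_nonneg (α := ℝ) n]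
    have hk0 : 0 < k := by
      by_contra hk0
      have : (k : ℝ) ≤ 0 := by exact_mod_cast not_lt.1 hk0
      nlinarith [Real.pi_pos]
    have : (1 : ℝ) ≤ k := by exact_mod_cast hk0
    nlinarith [Real.pi_gt_three]
  have hβt : Tendsto β atTop (𝓝 1) := by
    have h1 : Tendsto (fun n : ℕ => ((1 / ((n : ℝ) + 1) : ℝ) : ℂ) * Complex.I) atTop (𝓝 0) := by
      have := (Complex.continuous_ofReal.tendsto 0).comp
        (tendsto_one_div_add_atTop_nhds_zero_nat (𝕜 := ℝ))
      simpa using this.mul_const Complex.I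
    rw [← Complex.exp_zero]
    exact (Complex.continuous_exp.tendsto 0).comp h1
  have hW : Tendsto (fun n => (1 - β n) * ∑' s : ℤ, β n ^ s * poleTerm a q s) atTop (𝓝 0) := by
    have h0 : Tendsto (fun n => ‖1 - β n‖ * ∑' s : ℤ, ‖poleTerm a q s‖) atTop (𝓝 0) := by
      simpa using (hβt.const_sub 1).norm.mul_const (∑' s : ℤ, ‖poleTerm a q s‖)
    refine squeeze_zero_norm (fun n => ?_) h0
    rw [norm_mul]
    refine mul_le_mul_of_nonneg_left (tsum_of_norm_bounded hw.hasSum fun s => ?_) (norm_nonneg _)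
    rw [norm_mul, norm_zpow, hβ1, one_zpow, one_mul]
  have hinv := hβt.inv₀ one_ne_zero
  have hl : Tendsto (fun n => qPochInf (q * β n) q * qPochInf (q * (β n)⁻¹) q * qPochInf q q *
      (1 + (1 - β n) * ∑' s : ℤ, β n ^ s * poleTerm a q s)) atTop
      (𝓝 (qPochInf (q * 1) q * qPochInf (q * 1⁻¹) q * qPochInf q q * (1 + 0))) :=
    (((tendsto_qPochInf_comp hq (hβt.const_mul q)).mul
      (tendsto_qPochInf_comp hq (hinv.const_mul q))).mul_const _).mul (hW.const_add 1)
  have hr : Tendsto (fun n => (∑' s : ℤ, thetaCoeff q (0 - s) * (1 - a * q ^ s)⁻¹) *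
      (qPochInf (a * β n) q * qPochInf (q / a * (β n)⁻¹) q * qPochInf q q)) atTop
      (𝓝 ((∑' s : ℤ, thetaCoeff q (0 - s) * (1 - a * q ^ s)⁻¹) *
        (qPochInf (a * 1) q * qPochInf (q / a * 1⁻¹) q * qPochInf q q))) :=
    (((tendsto_qPochInf_comp hq (hβt.const_mul a)).mul
      (tendsto_qPochInf_comp hq (hinv.const_mul (q / a)))).mul_const _).const_mul _
  have h := tendsto_nhds_unique hl (hr.congr fun n => ?_)
  · simp only [mul_one, inv_one, add_zero] at h
    rw [theta, ← h]; ring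
  · have h1 := theta_mul_poleSeries hq0 hq ha0 ha (hβ1 n)
    rw [theta_eq_one_sub_mul _ hq, mul_assoc, mul_assoc (1 - β n)] at h1
    rw [div_eq_mul_inv q (β n)] at h1
    have h2 := mul_left_cancel₀ (hβne n) h1
    rw [h2, theta, div_mul_eq_div_div, div_eq_mul_inv (q / a)]

/-- Kronecker's product formula on the unit circle. -/
theorem theta_mul_theta_mul_poleSeries (hq0 : q ≠ 0) (hq : ‖q‖ < 1) (ha0 : a ≠ 0)
    (ha : ∀ k : ℤ, 1 - a * q ^ k ≠ 0) (hb : ‖b‖ = 1) :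
    theta a q * theta b q * (1 + (1 - b) * ∑' s : ℤ, b ^ s * poleTerm a q s) =
      (1 - b) * qPochInf q q ^ 3 * theta (a * b) q := by
  rw [← tsum_pole_mul_theta hq0 hq ha0 ha, mul_assoc, theta_mul_poleSeries hq0 hq ha0 ha hb]
  ring

end

/-! ### Product identities -/

section
variable {q w : ℂ}

lemma qPochInf_mul_neg (x : ℂ) (hq : ‖q‖ < 1) :
    qPochInf x q * qPochInf (-x) q = qPochInf (x ^ 2) (q ^ 2) := by
  refine tendsto_nhds_unique ((tendsto_qPoch x hq).mul (tendsto_qPoch (-x) hq))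
    ((tendsto_qPoch (x ^ 2) (norm_sq_lt_one hq)).congr fun n => ?_)
  rw [qPoch, qPoch, qPoch, ← Finset.prod_mul_distrib]
  exact Finset.prod_congr rfl fun i _ => by ring

lemma norm_cube_lt_one (hq : ‖q‖ < 1) : ‖q ^ 3‖ < 1 := by
  rw [norm_pow]; exact pow_lt_one₀ (norm_nonneg _) hq three_ne_zero

lemma qPochInf_mul_cubic (x : ℂ) (hq : ‖q‖ < 1) (hw : 1 + w + w ^ 2 = 0) :
    qPochInf x q * qPochInf (w * x) q * qPochInf (w ^ 2 * x) q = qPochInf (x ^ 3) (q ^ 3) := by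
  refine tendsto_nhds_unique (((tendsto_qPoch x hq).mul (tendsto_qPoch (w * x) hq)).mul
    (tendsto_qPoch (w ^ 2 * x) hq))
    ((tendsto_qPoch (x ^ 3) (norm_cube_lt_one hq)).congr fun n => ?_)
  rw [qPoch, qPoch, qPoch, qPoch, ← Finset.prod_mul_distrib, ← Finset.prod_mul_distrib]
  refine Finset.prod_congr rfl fun i _ => ?_
  rw [← pow_mul, mul_comm 3 i, pow_mul]
  generalize q ^ i = u
  linear_combination (u * x - w * u ^ 2 * x ^ 2 + (w - 1) * u ^ 3 * x ^ 3) * hw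

lemma qPochInf_self_ne_zero (hq : ‖q‖ < 1) : qPochInf q q ≠ 0 :=
  qPochInf_ne_zero hq (one_sub_pow_mul_ne_zero hq hq)

lemma qPochInf_neg_self_ne_zero (hq : ‖q‖ < 1) : qPochInf (-q) q ≠ 0 :=
  qPochInf_ne_zero hq (one_sub_pow_mul_neg_ne_zero hq)

lemma theta_self_cube (hq0 : q ≠ 0) (hq : ‖q‖ < 1) : theta q (q ^ 3) = qPochInf q q := by
  rw [qPochInf_mul_split q hq three_ne_zero, theta]
  simp only [Finset.prod_range_succ, Finset.prod_range_zero, one_mul, pow_zero]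
  rw [show q ^ 3 / q = q ^ 1 * q by field_simp, show q ^ 2 * q = q ^ 3 by ring]

/-- Gauss' identity `j(q; q ^ 2) = (q; q)_∞ / (-q; q)_∞`. -/
lemma theta_self_sq (hq0 : q ≠ 0) (hq : ‖q‖ < 1) :
    theta q (q ^ 2) * qPochInf (-q) q = qPochInf q q := by
  have h1 : qPochInf q q = qPochInf q (q ^ 2) * qPochInf (q ^ 2) (q ^ 2) := by
    rw [qPochInf_mul_split q hq two_ne_zero]
    simp only [Finset.prod_range_succ, Finset.prod_range_zero, one_mul, pow_zero]
    rw [show q ^ 1 * q = q ^ 2 by ring]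
  have h2 := qPochInf_mul_neg q hq
  have h3 := qPochInf_self_ne_zero hq
  have h4 : qPochInf q (q ^ 2) * qPochInf (-q) q = 1 := by
    rw [← h2] at h1
    exact mul_left_cancel₀ h3 (by linear_combination -h1)
  rw [theta, show q ^ 2 / q = q by field_simp]
  linear_combination qPochInf q (q ^ 2) * qPochInf (q ^ 2) (q ^ 2) * h4 - h1

lemma theta_neg_self_cube (hq0 : q ≠ 0) (hq : ‖q‖ < 1) :
    theta (-q) (q ^ 3) * qPochInf (-q ^ 3) (q ^ 3) =
      qPochInf (-q) q * qPochInf (q ^ 3) (q ^ 3) := by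
  rw [qPochInf_mul_split (-q) hq three_ne_zero, theta]
  simp only [Finset.prod_range_succ, Finset.prod_range_zero, one_mul, pow_zero]
  rw [show q ^ 3 / -q = q ^ 1 * -q by field_simp, show q ^ 2 * -q = -q ^ 3 by ring]
  ring

/-! ### Cubic specializations -/

lemma cube_root_ne_zero (hw : 1 + w + w ^ 2 = 0) : w ≠ 0 := by rintro rfl; norm_num at hw

lemma cube_root_pow_three (hw : 1 + w + w ^ 2 = 0) : w ^ 3 = 1 := by
  linear_combination (w - 1) * hw

lemma norm_cube_root (hw : 1 + w + w ^ 2 = 0) : ‖w‖ = 1 :=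
  Complex.norm_eq_one_of_pow_eq_one (cube_root_pow_three hw) three_ne_zero

lemma one_sub_cube_root_ne_zero (hw : 1 + w + w ^ 2 = 0) : 1 - w ≠ 0 := by
  intro h
  rw [← sub_eq_zero.1 h] at hw
  norm_num at hw

lemma one_sub_cube_root_mul_ne_zero (hq : ‖q‖ < 1) (hw : 1 + w + w ^ 2 = 0) (k : ℤ) :
    1 - w * q ^ k ≠ 0 := by
  rcases eq_or_ne k 0 with rfl | hk
  · simpa using one_sub_cube_root_ne_zero hw
  · intro h
    have h1 : ‖q‖ ^ k = 1 := by
      have := congrArg norm (sub_eq_zero.1 h)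
      rwa [norm_mul, norm_cube_root hw, one_mul, norm_one, norm_zpow, eq_comm] at this
    exact hk ((zpow_eq_one_iff_right₀ (norm_nonneg _) hq.ne).1 h1)

lemma inv_one_sub_cube_root_mul {u : ℂ} (hw : 1 + w + w ^ 2 = 0) (hu : 1 - u ^ 3 ≠ 0) :
    (1 - w * u)⁻¹ = (1 + w * u + w ^ 2 * u ^ 2) * (1 - u ^ 3)⁻¹ := by
  have h3 := cube_root_pow_three hw
  refine inv_eq_of_mul_eq_one_right ?_
  have h4 := mul_inv_cancel₀ hu
  linear_combination h4 - u ^ 3 * (1 - u ^ 3)⁻¹ * h3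

lemma inv_one_sub_inv_cube {u : ℂ} (hu0 : u ≠ 0) :
    (1 - (u⁻¹) ^ 3)⁻¹ = -(u ^ 3 * (1 - u ^ 3)⁻¹) := by
  rw [show 1 - u⁻¹ ^ 3 = -((u ^ 3)⁻¹ * (1 - u ^ 3)) by field_simp; ring, inv_neg, mul_inv, inv_inv]

lemma one_sub_inv_cube_ne_zero {u : ℂ} (hu0 : u ≠ 0) (hu : 1 - u ^ 3 ≠ 0) :
    1 - (u⁻¹) ^ 3 ≠ 0 := by
  intro h
  apply hu
  field_simp at h
  linear_combination -h

lemma cube_zpow (q : ℂ) (s : ℤ) : (q ^ 3) ^ s = (q ^ s) ^ 3 := by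
  rw [← zpow_natCast, ← zpow_natCast, ← zpow_mul, ← zpow_mul, mul_comm]

lemma one_sub_zpow_cube_ne_zero (hq : ‖q‖ < 1) {s : ℤ} (hs : s ≠ 0) :
    1 - (q ^ s) ^ 3 ≠ 0 := by
  rw [← cube_zpow]
  exact one_sub_zpow_ne_zero (norm_cube_lt_one hq) hs

lemma norm_cube_lt_norm (hq0 : q ≠ 0) (hq : ‖q‖ < 1) : ‖q ^ 3‖ < ‖q‖ := by
  rw [norm_pow]
  exact pow_lt_self_of_lt_one₀ (norm_pos_iff.2 hq0) hq (by norm_num)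

lemma summable_cubic_lambert (hq0 : q ≠ 0) (hq : ‖q‖ < 1) :
    Summable fun s : ℤ => (-q) ^ s * (1 - (q ^ 3) ^ s)⁻¹ :=
  (summable_int_lambert (pow_ne_zero 3 hq0) (norm_cube_lt_one hq)
    (by rw [norm_neg]; exact norm_cube_lt_norm hq0 hq) (by rwa [norm_neg])).of_norm

/-- Adding the terms s and -s and rationalizing 1 - ωu to 1 - u^3 turns the pole series into the
Lambert series in q^3. The term s = 0 on the Lambert side is 0 because 0⁻¹ = 0, so the value of the
pole series there is carried separately. -/
lemma poleSeries_cube_root (hq0 : q ≠ 0) (hq : ‖q‖ < 1) (hw : 1 + w + w ^ 2 = 0) :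
    (1 - w) * (1 + (1 - -1) * ∑' s : ℤ, (-1) ^ s * poleTerm w q s) =
      (1 + w) * (1 + 6 * ∑' s : ℤ, (-q) ^ s * (1 - (q ^ 3) ^ s)⁻¹) := by
  have hw1 := one_sub_cube_root_ne_zero hw
  have hp : Summable fun s : ℤ => (-1) ^ s * poleTerm w q s := by
    refine Summable.of_norm ?_
    simpa only [norm_mul, norm_zpow, norm_neg, norm_one, one_zpow, one_mul] using
      summable_poleTerm hq0 hq (cube_root_ne_zero hw) (one_sub_cube_root_mul_ne_zero hq hw)
  have hl := summable_cubic_lambert hq0 hq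
  have h1 := hp.hasSum.add ((Equiv.neg ℤ).hasSum_iff.2 hp.hasSum)
  have h2 := ((hl.hasSum.add ((Equiv.neg ℤ).hasSum_iff.2 hl.hasSum)).mul_left (w - w ^ 2)).add
    (hasSum_ite_eq (0 : ℤ) (2 * w / (1 - w)))
  have h3 := h1.unique (h2.congr_fun fun s => ?_)
  · have h4 : (1 - w) * (2 * w / (1 - w)) = 2 * w := by field_simp
    linear_combination (1 - w) * h3 + h4 + (2 * (w - 3)) *
      (∑' s : ℤ, (-q) ^ s * (1 - (q ^ 3) ^ s)⁻¹) * hw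
  · simp only [Function.comp, Equiv.neg_apply]
    rcases eq_or_ne s 0 with rfl | hs
    · simp only [neg_zero, zpow_zero, poleTerm, mul_one, le_refl, if_true, sub_self, inv_zero,
        mul_zero, add_zero, zero_add, one_mul]
      field_simp
      ring
    · have hu0 := zpow_ne_zero s hq0
      have hu := one_sub_zpow_cube_ne_zero hq hs
      have hsgn : (-1 : ℂ) ^ (-s) = (-1) ^ s := by rw [← inv_zpow', inv_neg_one]
      have hH : poleTerm w q s + poleTerm w q (-s) =
          (1 - w * q ^ s)⁻¹ + (1 - w * (q ^ s)⁻¹)⁻¹ - 1 := by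
        rw [poleTerm, poleTerm, zpow_neg]
        rcases lt_or_gt_of_ne hs with h | h
        · rw [if_neg (by omega), if_pos (by omega)]; ring
        · rw [if_pos (by omega), if_neg (by omega)]; ring
      rw [if_neg hs, add_zero, hsgn, ← mul_add, hH, neg_eq_neg_one_mul q, mul_zpow, mul_zpow, hsgn,
        cube_zpow, cube_zpow, zpow_neg, inv_one_sub_inv_cube hu0,
        inv_one_sub_cube_root_mul hw hu,
        inv_one_sub_cube_root_mul hw (one_sub_inv_cube_ne_zero hu0 hu),
        inv_one_sub_inv_cube hu0]
      generalize q ^ s = u at *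
      have h4 := mul_inv_cancel₀ hu
      have h5 := mul_inv_cancel₀ hu0
      generalize (1 - u ^ 3)⁻¹ = y at *
      have h6 : u⁻¹ * (u ^ 3 * y) = u ^ 2 * y := by field_simp
      have h7 : (w ^ 2 * u⁻¹ ^ 2) * (u ^ 3 * y) = w ^ 2 * u * y := by field_simp
      linear_combination (-1) ^ s * (-(w * h6) - h7 + (w - w ^ 2) * h6 + h4)

lemma exists_cube_root : ∃ w : ℂ, 1 + w + w ^ 2 = 0 := by
  refine ⟨(-1 + (Real.sqrt 3 : ℝ) * Complex.I) / 2, ?_⟩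
  have h : ((Real.sqrt 3 : ℝ) : ℂ) ^ 2 = 3 := by
    rw [← Complex.ofReal_pow, Real.sq_sqrt (by norm_num)]; norm_num
  linear_combination (Complex.I ^ 2 / 4) * h + (3 / 4) * Complex.I_sq

/-- Kronecker's formula at a = ω, b = -1, in which the products at x, ωx and ω²x combine to one in
base q^3, for x = q and x = -q. -/
theorem one_add_six_lambert (hq0 : q ≠ 0) (hq : ‖q‖ < 1) :
    (1 + 6 * ∑' s : ℤ, (-q) ^ s * (1 - (q ^ 3) ^ s)⁻¹) *
        (qPochInf (-q) q ^ 3 * qPochInf (q ^ 3) (q ^ 3)) =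
      qPochInf q q ^ 3 * qPochInf (-q ^ 3) (q ^ 3) := by
  obtain ⟨w, hw⟩ := exists_cube_root
  have hw0 := cube_root_ne_zero hw
  have hw3 := cube_root_pow_three hw
  have h1 := theta_mul_theta_mul_poleSeries (b := -1) hq0 hq hw0
    (one_sub_cube_root_mul_ne_zero hq hw) (by simp)
  have h2 := poleSeries_cube_root hq0 hq hw
  have h3 := qPochInf_mul_cubic q hq hw
  have h4 := qPochInf_mul_cubic (-q) hq hw
  have hE := qPochInf_self_ne_zero hq
  have h1w : 1 + w ≠ 0 := fun h => hw0 (pow_eq_zero_iff two_ne_zero |>.1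
    (by linear_combination hw - h))
  have hqw : q / w = w ^ 2 * q := by
    field_simp; linear_combination -hw3
  rw [theta_eq_one_sub_mul w hq, theta_eq_one_sub_mul (-1) hq, theta_eq_one_sub_mul (w * -1) hq,
    hqw, show q / (w * -1) = w ^ 2 * -q by rw [← div_div, hqw]; ring,
    show q * (w * -1) = w * -q by ring, show q * -1 = -q by ring, show q / -1 = -q by ring,
    mul_comm q w] at h1
  rw [show (-q) ^ 3 = -q ^ 3 by ring] at h4
  rw [← h3, ← h4]
  generalize ∑' s : ℤ, (-1) ^ s * poleTerm w q s = W at *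
  generalize ∑' s : ℤ, (-q) ^ s * (1 - (q ^ 3) ^ s)⁻¹ = Λ at *
  generalize qPochInf q q = E at *
  generalize qPochInf (-q) q = n at *
  generalize qPochInf (w * q) q = A at *
  generalize qPochInf (w ^ 2 * q) q = B at *
  generalize qPochInf (w * -q) q = C at *
  generalize qPochInf (w ^ 2 * -q) q = D at *
  have h5 : (2 * (1 + w) * E) * (A * B * n ^ 2 * E * (1 + 6 * Λ) - E ^ 3 * C * D) = 0 := by
    linear_combination h1 - (2 * A * B * n ^ 2 * E ^ 2) * h2
  have h6 := (mul_eq_zero.1 h5).resolve_left (mul_ne_zero (mul_ne_zero two_ne_zero h1w) hE)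
  linear_combination n * h6

/-- The rank generating function at a primitive cube root of unity. -/
theorem durfee_cube_root (hq0 : q ≠ 0) (hq : ‖q‖ < 1) (hw : 1 + w + w ^ 2 = 0) :
    qPochInf q q * ∑' n : ℕ, q ^ n ^ 2 / (qPoch (w * q) q n * qPoch (q / w) q n) =
      1 - 3 * ∑' s, thetaLambertTerm q (q ^ 3) 0 s := by
  have hw1 := one_sub_cube_root_ne_zero hw
  have hR := hasSum_rank_appellLerch hq0 hq (cube_root_ne_zero hw)
    (one_sub_cube_root_mul_ne_zero hq hw)
  have hT := (summable_thetaLambertTerm (x := q) (pow_ne_zero 3 hq0)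
    (norm_cube_lt_one hq) hq0 0).hasSum
  -- Symmetrizing k ↦ -k clears ω from the denominators; the same is done to T, and the central term
  -- contributes 2.
  have h1 := hR.add ((Equiv.neg ℤ).hasSum_iff.2 hR)
  have h2 := (hasSum_ite_eq (0 : ℤ) (2 : ℂ)).sub
    ((hT.add ((Equiv.neg ℤ).hasSum_iff.2 hT)).mul_left 3)
  have hT' (s : ℤ) : thetaLambertTerm q (q ^ 3) 0 s =
      thetaCoeff q s * q ^ (s * s) * (q ^ s) ^ 3 * (1 - (q ^ s) ^ 3)⁻¹ := by
    have e1 : thetaCoeff (q ^ 3) s = thetaCoeff q s * (thetaCoeff q s * thetaCoeff q s) := by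
      have : (-1 : ℂ) ^ s * (-1) ^ s = 1 := by rw [← mul_zpow]; simp
      rw [thetaCoeff, thetaCoeff, cube_zpow]
      linear_combination (-(-1) ^ s * (q ^ (s * (s - 1) / 2)) ^ 3) * this
    rw [thetaLambertTerm, e1, thetaCoeff_mul_self hq0, sub_zero, zpow_one, mul_zpow, cube_zpow,
      zpow_sub₀ hq0]
    have := zpow_ne_zero s hq0
    field_simp
  have h3 := h1.unique (h2.congr_fun fun s => ?_)
  · linear_combination h3 / 2
  · simp only [Function.comp, Equiv.neg_apply]
    rcases eq_or_ne s 0 with rfl | hs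
    · simp only [hT', partialFractionCoeff, thetaCoeff_zero]
      norm_num
      field_simp
      norm_num [thetaCoeff_zero]
    · have hu0 := zpow_ne_zero s hq0
      have hu := one_sub_zpow_cube_ne_zero hq hs
      rw [if_neg hs, hT', hT', partialFractionCoeff, partialFractionCoeff, thetaCoeff_neg hq0,
        neg_mul_neg, zpow_neg, inv_one_sub_inv_cube hu0, inv_one_sub_cube_root_mul hw hu,
        inv_one_sub_cube_root_mul hw (one_sub_inv_cube_ne_zero hu0 hu),
        inv_one_sub_inv_cube hu0]
      generalize q ^ s = u at *
      generalize (1 - u ^ 3)⁻¹ = y at *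
      generalize thetaCoeff q s = e at *
      generalize q ^ (s * s) = f at *
      field_simp
      linear_combination (e * u * y * f * (1 - u ^ 2) * (w - 2)) * hw

lemma theta_neg_one_ne_zero (hq : ‖q‖ < 1) : theta (-1) q ≠ 0 := by
  have h (i : ℕ) : 1 - q ^ i * (-1) ≠ 0 := by
    rcases i with _ | i
    · norm_num
    · rw [pow_succ, mul_assoc, mul_neg_one]
      exact one_sub_pow_mul_ne_zero hq (by rwa [norm_neg]) i
  refine mul_ne_zero (mul_ne_zero (qPochInf_ne_zero hq h) ?_) (qPochInf_self_ne_zero hq)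
  rw [div_neg, div_one]
  exact qPochInf_neg_self_ne_zero hq

lemma theta_neg_self_cube_ne_zero (hq0 : q ≠ 0) (hq : ‖q‖ < 1) : theta (-q) (q ^ 3) ≠ 0 :=
  left_ne_zero_of_mul (b := qPochInf (-q ^ 3) (q ^ 3)) <| by
    rw [theta_neg_self_cube hq0 hq]
    exact mul_ne_zero (qPochInf_neg_self_ne_zero hq) (qPochInf_self_ne_zero (norm_cube_lt_one hq))

theorem cube_root_durfee_eq (hq0 : q ≠ 0) (hq : ‖q‖ < 1) (hw : 1 + w + w ^ 2 = 0) :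
    ∑' n : ℕ, q ^ n ^ 2 / (qPoch (w * q) q n * qPoch (q / w) q n) =
      3 * appell q (q ^ 3) (-1) - 1 / 2 * (theta q (q ^ 2) ^ 2 / theta (-q) (q ^ 3)) := by
  have h1 := durfee_cube_root hq0 hq hw
  have h2 := theta_mul_appell_neg_one (pow_ne_zero 3 hq0) (norm_cube_lt_norm hq0 hq) hq
  have h3 := one_add_six_lambert hq0 hq
  have h4 := theta_self_sq hq0 hq
  have h5 := theta_neg_self_cube hq0 hq
  have hθ := theta_neg_one_ne_zero (norm_cube_lt_one hq)
  have hJ := theta_neg_self_cube_ne_zero hq0 hq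
  have hE := qPochInf_self_ne_zero hq
  have hE3 := qPochInf_self_ne_zero (norm_cube_lt_one hq)
  have hn := qPochInf_neg_self_ne_zero hq
  rw [theta_self_cube hq0 hq] at h2
  rw [appell]
  generalize ∑' r, appellTerm q (q ^ 3) (-1) r = A at *
  generalize ∑' s, thetaLambertTerm q (q ^ 3) 0 s = T at *
  generalize ∑' s : ℤ, (-q) ^ s * (1 - (q ^ 3) ^ s)⁻¹ = L at *
  generalize (∑' n : ℕ, q ^ n ^ 2 / (qPoch (w * q) q n * qPoch (q / w) q n)) = R at *
  generalize qPochInf q q = E at *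
  generalize qPochInf (-q) q = n at *
  generalize theta (-1) (q ^ 3) = t at *
  generalize theta (-q) (q ^ 3) = Jb at *
  generalize theta q (q ^ 2) = J at *
  generalize qPochInf (q ^ 3) (q ^ 3) = F at *
  generalize qPochInf (-q ^ 3) (q ^ 3) = N at *
  -- The product value of 1 + 6Λ in theta form. With it, R(ω) - 3m = -(1 + 6Λ)/(2E) is the required
  -- theta quotient.
  have h6 : (1 + 6 * L) * Jb = E * J ^ 2 := by
    refine mul_right_cancel₀ (mul_ne_zero (pow_ne_zero 3 hn) hE3) ?_
    linear_combination Jb * h3 + E ^ 3 * h5 - E * n * F * (J * n + E) * h4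
  have hA : A = t * (L - T + 1 / 2) / E := by
    rw [eq_div_iff hE]; linear_combination h2
  have hR : R = (1 - 3 * T) / E := by
    rw [eq_div_iff hE]; linear_combination h1
  rw [hA, hR]
  field_simp
  linear_combination -h6

end

/-! ### The two-variable generating function of partitions -/

section
variable {q y ζ : ℂ}

/-- Multisets of positive integers. -/
def positiveParts : Set (Multiset ℕ) := {s | ∀ i ∈ s, 0 < i}

/-- Multisets of positive integers that are at most `m`. -/
def partsAtMost (m : ℕ) : Set (Multiset ℕ) := {s | ∀ i ∈ s, 0 < i ∧ i ≤ m}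

/-- The weight of a multiset that records its cardinality and its sum. -/
noncomputable def partWeight (y q : ℂ) (s : Multiset ℕ) : ℂ := y ^ s.card * q ^ s.sum

/-- Splitting off the parts equal to `m + 1`. -/
def partsAtMostSuccEquiv (m : ℕ) : ℕ × partsAtMost m ≃ partsAtMost (m + 1) where
  toFun a := ⟨Multiset.replicate a.1 (m + 1) + a.2.1, fun i hi => by
    rcases Multiset.mem_add.1 hi with h | h
    · rw [Multiset.eq_of_mem_replicate h]; omega
    · have := a.2.2 i h; omega⟩
  invFun s := (s.1.count (m + 1), ⟨s.1.filter (fun i => ¬ i = m + 1), fun i hi => by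
    have h := Multiset.mem_filter.1 hi
    have := s.2 i h.1
    omega⟩)
  left_inv a := by
    obtain ⟨j, s, hs⟩ := a
    have h : m + 1 ∉ s := fun h => by have := hs _ h; omega
    refine Prod.ext ?_ (Subtype.ext ?_)
    · simp [Multiset.count_eq_zero_of_notMem h]
    · simp only [Multiset.filter_add]
      rw [Multiset.filter_eq_nil.2, zero_add, Multiset.filter_eq_self.2]
      · exact fun i hi e => h (e ▸ hi)
      · exact fun i hi => not_not.2 (Multiset.eq_of_mem_replicate hi)
  right_inv s := by
    refine Subtype.ext ?_
    simp only
    rw [← Multiset.filter_eq', Multiset.filter_add_not]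

lemma hasSum_partsAtMost (hy : ‖y‖ ≤ 1) (hq : ‖q‖ < 1) (m : ℕ) :
    HasSum (fun s : partsAtMost m => partWeight y q s) (qPoch (y * q) q m)⁻¹ ∧
      Summable (fun s : partsAtMost m => ‖partWeight y q s‖) := by
  induction m with
  | zero =>
    have h : partsAtMost 0 = {0} := by
      ext s
      refine ⟨fun h => Multiset.eq_zero_of_forall_notMem fun i hi => ?_, ?_⟩
      · have := h i hi; omega
      · rintro rfl i hi; simp at hi
    rw [h]
    have : Finite ({0} : Set (Multiset ℕ)) := Set.finite_singleton 0
    refine ⟨?_, Summable.of_finite⟩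
    have h2 := hasSum_unique (fun s : ({0} : Set (Multiset ℕ)) => partWeight y q s)
    simpa [qPoch_zero, partWeight] using h2
  | succ m ih =>
    have hr : ‖y * q ^ (m + 1)‖ < 1 := by
      rw [norm_mul, norm_pow]
      exact (mul_le_of_le_one_left (by positivity) hy).trans_lt
        (pow_lt_one₀ (norm_nonneg q) hq (by omega))
    have hg := hasSum_geometric_of_norm_lt_one hr
    have hgn : Summable fun j : ℕ => ‖(y * q ^ (m + 1)) ^ j‖ := by
      simp_rw [norm_pow]
      exact summable_geometric_of_lt_one (norm_nonneg _) hr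
    have he (a : ℕ × partsAtMost m) : partWeight y q (partsAtMostSuccEquiv m a) =
        (y * q ^ (m + 1)) ^ a.1 * partWeight y q a.2 := by
      simp only [partsAtMostSuccEquiv, partWeight, Equiv.coe_fn_mk, Multiset.card_add,
        Multiset.card_replicate, Multiset.sum_add, Multiset.sum_replicate, smul_eq_mul]
      ring
    have hn := summable_mul_of_summable_norm hgn ih.2
    have hn' := Summable.mul_norm hgn ih.2
    refine ⟨(partsAtMostSuccEquiv m).hasSum_iff.1 ?_, (partsAtMostSuccEquiv m).summable_iff.1 ?_⟩
    · have h := hg.mul ih.1 hn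
      rw [qPoch_succ, mul_inv_rev, show q ^ m * (y * q) = y * q ^ (m + 1) by ring]
      exact h.congr_fun he
    · exact hn'.congr fun a => by rw [← he]; rfl

/-- With |q| and y = 1 as weights, any finite set of such multisets has bounded parts. Its sum is
therefore at most 1/(|q|; |q|)_m for some m, and these numbers are bounded. -/
lemma summable_positiveParts (hq : ‖q‖ < 1) (hy : ‖y‖ ≤ 1) :
    Summable fun s : positiveParts => ‖partWeight y q s‖ := by
  have hr : ‖(‖q‖ : ℂ)‖ < 1 := by simpa using hq
  obtain ⟨C, -, hC⟩ := exists_bound_inv_qPoch hr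
    (one_sub_pow_mul_ne_zero (x := 1 * (‖q‖ : ℂ)) hr (by simpa using hq))
  have key (m : ℕ) : ∑' s : partsAtMost m, ‖partWeight 1 (‖q‖ : ℂ) s‖ ≤ C := by
    have h := (hasSum_partsAtMost (y := 1) (by simp) hr m).1
    have e (s : Multiset ℕ) : partWeight 1 (‖q‖ : ℂ) s = (‖partWeight 1 (‖q‖ : ℂ) s‖ : ℝ) := by
      simp [partWeight]
    have h2 := hC m
    rw [← h.tsum_eq, tsum_congr fun s : partsAtMost m => e s, ← Complex.ofReal_tsum,
      Complex.norm_real] at h2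
    exact (le_abs_self _).trans h2
  have hle (s : Multiset ℕ) : ‖partWeight y q s‖ ≤ ‖partWeight 1 (‖q‖ : ℂ) s‖ := by
    simp only [partWeight, norm_mul, norm_pow, one_pow, one_mul, Complex.norm_real,
      norm_norm]
    exact mul_le_of_le_one_left (by positivity) (pow_le_one₀ (norm_nonneg _) hy)
  refine summable_of_sum_le (c := C) (fun _ => norm_nonneg _) fun u => ?_
  obtain ⟨m, hm⟩ : ∃ m, ∀ s ∈ u, s.1 ∈ partsAtMost m := by
    refine ⟨u.sup fun s => s.1.sup, fun s hs i hi => ⟨s.2 i hi, ?_⟩⟩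
    exact (Multiset.le_sup hi).trans (Finset.le_sup (f := fun s : positiveParts => s.1.sup) hs)
  refine le_trans ?_ (key m)
  refine (Finset.sum_le_sum fun (s : positiveParts) _ => hle s).trans ?_
  have hs := (hasSum_partsAtMost (y := 1) (by simp) hr m).2
  calc ∑ s ∈ u, ‖partWeight 1 (‖q‖ : ℂ) s‖
      = ∑ s ∈ u.attach.map ⟨fun s => (⟨s.1.1, hm _ s.2⟩ : partsAtMost m), fun a b h =>
          Subtype.ext (Subtype.ext (congrArg (fun s => s.1) h))⟩, ‖partWeight 1 (‖q‖ : ℂ) s‖ := by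
        rw [Finset.sum_map, ← Finset.sum_attach]; rfl
    _ ≤ _ := hs.sum_le_tsum _ fun _ _ => norm_nonneg _

/-- Removing one largest part. -/
def consLargestEquiv (m : ℕ) :
    partsAtMost (m + 1) ≃ (fun s : positiveParts => s.1.sup) ⁻¹' {m + 1} where
  toFun s := ⟨⟨(m + 1) ::ₘ s.1, fun i hi => by
      rcases Multiset.mem_cons.1 hi with rfl | h
      · omega
      · exact (s.2 i h).1⟩, by
    simp only [Set.mem_preimage, Set.mem_singleton_iff, Multiset.sup_cons, sup_eq_left]
    exact Multiset.sup_le.2 fun i hi => (s.2 i hi).2⟩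
  invFun s := ⟨s.1.1.erase (m + 1), fun i hi => by
    have h := Multiset.mem_of_mem_erase hi
    exact ⟨s.1.2 i h, (Multiset.le_sup h).trans s.2.le⟩⟩
  left_inv s := Subtype.ext (Multiset.erase_cons_head _ _)
  right_inv s := by
    refine Subtype.ext (Subtype.ext (Multiset.cons_erase ?_))
    obtain ⟨⟨s, h1⟩, h2⟩ := s
    simp only [Set.mem_preimage, Set.mem_singleton_iff] at h2
    by_contra h
    have : s.sup ≤ m := Multiset.sup_le.2 fun i hi => by
      have h3 : i ≤ m + 1 := (Multiset.le_sup hi).trans h2.le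
      have h4 : i ≠ m + 1 := fun e => h (e ▸ hi)
      omega
    omega

/-- Partitions of `n` are the multisets of positive integers with sum `n`. -/
def partitionEquiv (n : ℕ) :
    Nat.Partition n ≃ (fun s : positiveParts => s.1.sum) ⁻¹' {n} where
  toFun p := ⟨⟨p.parts, fun _ hi => p.parts_pos hi⟩, p.parts_sum⟩
  invFun s := ⟨s.1.1, fun hi => s.1.2 _ hi, s.2⟩
  left_inv _ := rfl
  right_inv _ := rfl

/-- The generating function of the rank. -/
theorem hasSum_rank (hζ : ‖ζ‖ = 1) (hq : ‖q‖ < 1) :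
    HasSum (fun n => (∑ p : Nat.Partition n, ζ ^ rank p) * q ^ n)
      (1 + ∑' m : ℕ, ζ ^ m * q ^ (m + 1) / qPoch (q / ζ) q (m + 1)) := by
  have hζ0 : ζ ≠ 0 := norm_ne_zero_iff.1 (by rw [hζ]; norm_num)
  have hy : ‖ζ⁻¹‖ ≤ 1 := by rw [norm_inv, hζ, inv_one]
  have hs : Summable fun s : positiveParts => ζ ^ s.1.sup * partWeight ζ⁻¹ q s := by
    refine Summable.of_norm ((summable_positiveParts hq hy).congr fun s => ?_)
    rw [norm_mul, norm_pow, hζ, one_pow, one_mul]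
  -- The same absolutely convergent sum is fibred twice: by the sum of the parts, which gives the
  -- coefficients of q^n, and by the largest part, which gives the series on the right. The fibre of
  -- largest part 0 is the empty partition.
  have h1 := hs.hasSum.tsum_fiberwise fun s : positiveParts => s.1.sum
  have h2 := hs.hasSum.tsum_fiberwise fun s : positiveParts => s.1.sup
  have e2 (m : ℕ) : ∑' s : (fun s : positiveParts => s.1.sup) ⁻¹' {m + 1},
      ζ ^ s.1.1.sup * partWeight ζ⁻¹ q s.1 = ζ ^ m * q ^ (m + 1) / qPoch (q / ζ) q (m + 1) := by
    rw [← (consLargestEquiv m).tsum_eq]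
    have h3 (s : partsAtMost (m + 1)) :
        ζ ^ (consLargestEquiv m s).1.1.sup * partWeight ζ⁻¹ q (consLargestEquiv m s).1 =
          ζ ^ m * q ^ (m + 1) * partWeight ζ⁻¹ q s := by
      rw [show (consLargestEquiv m s).1.1.sup = m + 1 from (consLargestEquiv m s).2]
      simp only [consLargestEquiv, partWeight, Equiv.coe_fn_mk, Multiset.card_cons,
        Multiset.sum_cons]
      rw [pow_add q, pow_succ ζ, pow_succ ζ⁻¹]
      field_simp
    rw [tsum_congr h3, tsum_mul_left, (hasSum_partsAtMost hy hq (m + 1)).1.tsum_eq, div_eq_mul_inv,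
      div_eq_inv_mul]
  have e0 : ∑' s : (fun s : positiveParts => s.1.sup) ⁻¹' {0},
      ζ ^ s.1.1.sup * partWeight ζ⁻¹ q s.1 = 1 := by
    have hz (s : (fun s : positiveParts => s.1.sup) ⁻¹' {0}) : s.1.1 = 0 :=
      Multiset.eq_zero_of_forall_notMem fun i hi =>
        (s.1.2 i hi).ne' (Nat.le_zero.1 ((Multiset.le_sup hi).trans s.2.le))
    have h0 : (0 : Multiset ℕ) ∈ positiveParts := fun i hi => by simp at hi
    rw [tsum_eq_single ⟨⟨0, h0⟩, rfl⟩]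
    · simp [partWeight]
    · exact fun s hs => (hs (Subtype.ext (Subtype.ext (hz s)))).elim
  have h3 := h2.summable.tsum_eq_zero_add
  rw [h2.tsum_eq, e0, tsum_congr e2] at h3
  rw [← h3]
  refine h1.congr_fun fun n => ?_
  rw [← (partitionEquiv n).tsum_eq, tsum_fintype, Finset.sum_mul]
  refine Finset.sum_congr rfl fun p _ => ?_
  simp only [partitionEquiv, Equiv.coe_fn_mk, partWeight, rank, p.parts_sum]
  rw [zpow_sub₀ hζ0, zpow_natCast, zpow_natCast, inv_pow]
  ring

/-- At ζ = 1 and nome |q| the rank series is the generating function of p(n). -/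
lemma summable_partitionCount (hq : ‖q‖ < 1) :
    Summable fun n => (partitionCount n : ℝ) * ‖q‖ ^ n := by
  have h := (hasSum_rank (ζ := 1) (q := (‖q‖ : ℂ)) (by simp) (by simpa using hq)).summable
  refine Complex.summable_ofReal.1 (h.congr fun n => ?_)
  simp [partitionCount]

end

/-! ### Rank deviations modulo two and three -/

section
variable {q w : ℂ}

lemma rankCount_eq_sum (a : ℤ) (M n : ℕ) :
    (rankCount a M n : ℂ) =
      ∑ p : Nat.Partition n, if rank p ≡ a [ZMOD (M : ℤ)] then (1 : ℂ) else 0 := by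
  rw [rankCount, Finset.sum_boole]

lemma partitionCount_eq_sum (n : ℕ) : (partitionCount n : ℂ) = ∑ _p : Nat.Partition n, (1 : ℂ) := by
  simp [partitionCount]

lemma summable_deviationTerm (hq : ‖q‖ < 1) (a : ℤ) (M : ℕ) : Summable (deviationTerm a M q) := by
  refine Summable.of_norm_bounded ((summable_partitionCount hq).mul_left 2) fun n => ?_
  have h1 : (rankCount a M n : ℝ) ≤ partitionCount n := by
    exact_mod_cast Finset.card_filter_le _ _
  have h2 : ‖(partitionCount n : ℂ) / M‖ ≤ partitionCount n := by
    rw [norm_div, Complex.norm_natCast, Complex.norm_natCast]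
    rcases Nat.eq_zero_or_pos M with rfl | hM
    · simp
    · exact div_le_self (by positivity) (by exact_mod_cast hM)
  rw [deviationTerm, norm_mul, norm_pow, ← mul_assoc]
  gcongr
  refine (norm_sub_le _ _).trans ?_
  rw [Complex.norm_natCast]
  linarith

lemma ite_modEq_two (r a : ℤ) :
    (if r ≡ a [ZMOD 2] then (1 : ℂ) else 0) = (1 + (-1) ^ (r - a)) / 2 := by
  rcases Int.even_or_odd (r - a) with h | h
  · rw [if_pos (Int.modEq_iff_dvd.2 ((dvd_sub_comm).1 h.two_dvd)), h.neg_one_zpow]; norm_num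
  · rw [if_neg, h.neg_one_zpow]
    · norm_num
    · exact fun e => (Int.not_even_iff_odd.2 h)
        (even_iff_two_dvd.2 (dvd_sub_comm.1 (Int.modEq_iff_dvd.1 e)))

lemma ite_modEq_three (hw : 1 + w + w ^ 2 = 0) (r a : ℤ) :
    (if r ≡ a [ZMOD 3] then (1 : ℂ) else 0) = (1 + w ^ (r - a) + (w ^ 2) ^ (r - a)) / 3 := by
  have h3 := cube_root_pow_three hw
  have hw0 := cube_root_ne_zero hw
  obtain ⟨k, hk⟩ : ∃ k, k = (r - a) / 3 := ⟨_, rfl⟩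
  have hpow (j : ℕ) : w ^ (3 * k + j : ℤ) = w ^ j := by
    rw [zpow_add₀ hw0, zpow_mul]
    norm_cast
    rw [h3, one_zpow, one_mul]
  rw [← zpow_natCast w 2, ← zpow_mul, mul_comm, zpow_mul, zpow_natCast]
  obtain ⟨j, hj, hj3⟩ : ∃ j : ℕ, r - a = 3 * k + j ∧ j < 3 :=
    ⟨((r - a) % 3).toNat, by omega, by omega⟩
  rw [hj, hpow]
  interval_cases j
  · rw [if_pos (Int.modEq_iff_dvd.2 ⟨-k, by push_cast at hj; omega⟩)]; norm_num
  · rw [if_neg fun e => by have := Int.modEq_iff_dvd.1 e; omega]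
    linear_combination -hw / 3
  · rw [if_neg fun e => by have := Int.modEq_iff_dvd.1 e; omega]
    linear_combination (-hw - w * h3) / 3

lemma deviation_two (hq : ‖q‖ < 1) (a : ℤ) :
    deviation a 2 q = (-1) ^ (-a) / 2 *
      (1 + ∑' m : ℕ, (-1) ^ m * q ^ (m + 1) / qPoch (q / -1) q (m + 1)) := by
  refine (((hasSum_rank (ζ := -1) (by simp) hq).mul_left _).congr_fun fun n => ?_).tsum_eq
  rw [deviationTerm, rankCount_eq_sum, partitionCount_eq_sum, Finset.sum_div,
    ← Finset.sum_sub_distrib, ← mul_assoc, Finset.mul_sum]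
  congr 1
  refine Finset.sum_congr rfl fun p _ => ?_
  have := ite_modEq_two (rank p) a
  push_cast
  rw [this, sub_eq_neg_add (rank p), zpow_add₀ (by norm_num)]
  ring

/-- The evaluation of R is the same at w and w^2, so it factors out of the root-of-unity filter. -/
lemma deviation_three (hq0 : q ≠ 0) (hq : ‖q‖ < 1) (hw : 1 + w + w ^ 2 = 0) (a : ℤ) :
    deviation a 3 q = (w ^ (-a) + (w ^ 2) ^ (-a)) / 3 *
      (3 * appell q (q ^ 3) (-1) - 1 / 2 * (theta q (q ^ 2) ^ 2 / theta (-q) (q ^ 3))) := by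
  have hR {v : ℂ} (hv : 1 + v + v ^ 2 = 0) :
      HasSum (fun n => (∑ p : Nat.Partition n, v ^ rank p) * q ^ n)
        (3 * appell q (q ^ 3) (-1) - 1 / 2 * (theta q (q ^ 2) ^ 2 / theta (-q) (q ^ 3))) := by
    have hv1 := norm_cube_root hv
    rw [← cube_root_durfee_eq hq0 hq hv, (hasSum_durfee (cube_root_ne_zero hv) hq
      (by rwa [norm_mul, hv1, one_mul])
      (one_sub_pow_mul_ne_zero hq (by rwa [norm_div, hv1, div_one]))).tsum_eq]
    exact hasSum_rank hv1 hq
  have hw2 : 1 + w ^ 2 + (w ^ 2) ^ 2 = 0 := by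
    linear_combination (1 - w + w ^ 2) * hw
  have hw0 := cube_root_ne_zero hw
  have h := ((hR hw).mul_left (w ^ (-a) / 3)).add ((hR hw2).mul_left ((w ^ 2) ^ (-a) / 3))
  rw [add_div, add_mul]
  refine (h.congr_fun fun n => ?_).tsum_eq
  rw [deviationTerm, rankCount_eq_sum, partitionCount_eq_sum, Finset.sum_div,
    ← Finset.sum_sub_distrib, ← mul_assoc, ← mul_assoc, Finset.mul_sum, Finset.mul_sum, ← add_mul,
    ← Finset.sum_add_distrib]
  congr 1
  refine Finset.sum_congr rfl fun p _ => ?_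
  have := ite_modEq_three hw (rank p) a
  push_cast
  rw [this, sub_eq_neg_add (rank p), zpow_add₀ hw0, zpow_add₀ (pow_ne_zero 2 hw0)]
  ring

/-! ### The J-notation and the evaluations in the case M = 2 -/

lemma J_one_two (q : ℂ) : J 1 2 q = theta q (q ^ 2) := by rw [J, zpow_one]

lemma Jbar_one_three (q : ℂ) : Jbar 1 3 q = theta (-q) (q ^ 3) := by rw [Jbar, zpow_one]

lemma Jsingle_one (hq0 : q ≠ 0) (hq : ‖q‖ < 1) : Jsingle 1 q = qPochInf q q := by
  rw [Jsingle, J, Nat.cast_one, zpow_one, mul_one, theta_self_cube hq0 hq]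

lemma one_sub_cube_zpow_mul_ne_zero (hq0 : q ≠ 0) (hq : ‖q‖ < 1) (r : ℤ) :
    1 - (q ^ 3) ^ (r - 1) * q * (-1) ≠ 0 := by
  have h : (q ^ 3) ^ (r - 1) * q = q ^ (3 * r - 2) := by
    rw [← zpow_natCast q 3, ← zpow_mul, ← zpow_add_one₀ hq0]
    congr 1; push_cast; ring
  intro e
  have h1 : ‖q‖ ^ (3 * r - 2) = 1 := by
    rw [← norm_zpow, ← h, show (q ^ 3) ^ (r - 1) * q = -1 by linear_combination e]; simp
  have h2 := (zpow_eq_one_iff_right₀ (norm_nonneg q) hq.ne).1 h1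
  omega

lemma deviation_zero_two (hq0 : q ≠ 0) (hq : ‖q‖ < 1) :
    deviation 0 2 q = 2 * q * g (-q) (q ^ 4) + 1 / 2 * (J 1 2 q ^ 2 / Jsingle 1 q) := by
  have h := theta_self_sq hq0 hq
  have hn := qPochInf_neg_self_ne_zero hq
  have hE := qPochInf_self_ne_zero hq
  rw [deviation_two hq, div_neg, div_one, alternating_fine_eq_gTerm hq0 hq, g, J_one_two,
    Jsingle_one hq0 hq, neg_zero, zpow_zero]
  generalize ∑' n, gTerm (-q) (q ^ 4) n = G
  generalize theta q (q ^ 2) = t at *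
  generalize qPochInf (-q) q = n at *
  generalize qPochInf q q = E at *
  subst h
  have ht := left_ne_zero_of_mul hE
  field_simp
  ring

lemma deviation_one_two (hq : ‖q‖ < 1) : deviation 1 2 q = -deviation 0 2 q := by
  rw [deviation_two hq, deviation_two hq]
  norm_num

end

end DysonRank

theorem mainTheorem5 (q : ℂ) (hq0 : 0 < ‖q‖) (hq1 : ‖q‖ < 1) :
    -- all the series in question converge absolutely
    ((∀ (a : ℤ) (M : ℕ), 0 < M → Summable (DysonRank.deviationTerm a M q)) ∧
      Summable (DysonRank.gTerm (-q) (q ^ 4)) ∧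
      Summable (DysonRank.appellTerm q (q ^ 3) (-1))) ∧
    -- none of the denominators vanishes
    ((∀ n : ℕ, DysonRank.qPoch (-q) (q ^ 4) (n + 1) * DysonRank.qPoch (q ^ 4 / -q) (q ^ 4) n ≠ 0) ∧
      (∀ r : ℤ, 1 - (q ^ 3) ^ (r - 1) * q * (-1) ≠ 0) ∧
      DysonRank.theta (-1) (q ^ 3) ≠ 0 ∧
      DysonRank.Jsingle 1 q ≠ 0 ∧ DysonRank.Jbar 1 3 q ≠ 0) ∧
    -- the case `M = 2`
    (DysonRank.deviation 0 2 q =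
        2 * q * DysonRank.g (-q) (q ^ 4)
          + 1 / 2 * (DysonRank.J 1 2 q ^ 2 / DysonRank.Jsingle 1 q) ∧
      DysonRank.deviation 1 2 q = -DysonRank.deviation 0 2 q ∧
      DysonRank.deviation 1 2 q =
        -2 * q * DysonRank.g (-q) (q ^ 4)
          - 1 / 2 * (DysonRank.J 1 2 q ^ 2 / DysonRank.Jsingle 1 q)) ∧
    -- the case `M = 3`
    (DysonRank.deviation 0 3 q =
        2 * DysonRank.appell q (q ^ 3) (-1)
          - 1 / 3 * (DysonRank.J 1 2 q ^ 2 / DysonRank.Jbar 1 3 q) ∧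
      DysonRank.deviation 1 3 q = DysonRank.deviation 2 3 q ∧
      DysonRank.deviation 2 3 q = -DysonRank.deviation 0 3 q / 2 ∧
      DysonRank.deviation 1 3 q =
        -DysonRank.appell q (q ^ 3) (-1)
          + 1 / 6 * (DysonRank.J 1 2 q ^ 2 / DysonRank.Jbar 1 3 q)) := by

  have hq : q ≠ 0 := norm_pos_iff.1 hq0
  obtain ⟨w, hw⟩ := DysonRank.exists_cube_root
  have hw0 := DysonRank.cube_root_ne_zero hw
  have h12 := DysonRank.deviation_one_two hq1
  have h02 := DysonRank.deviation_zero_two hq hq1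
  have h03 := DysonRank.deviation_three hq hq1 hw 0
  have e1 : w ^ (-1 : ℤ) + (w ^ 2) ^ (-1 : ℤ) = -1 := by
    rw [zpow_neg_one, zpow_neg_one]
    field_simp
    linear_combination hw
  have e2 : w ^ (-2 : ℤ) + (w ^ 2) ^ (-2 : ℤ) = -1 := by
    have h3 := DysonRank.cube_root_pow_three hw
    rw [zpow_neg, zpow_neg, zpow_ofNat, zpow_ofNat]
    field_simp
    linear_combination w * h3 + hw
  have h13 := DysonRank.deviation_three hq hq1 hw 1
  have h23 := DysonRank.deviation_three hq hq1 hw 2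
  rw [e1] at h13
  rw [e2] at h23
  rw [neg_zero, zpow_zero, zpow_zero] at h03
  refine ⟨⟨fun a M _ => DysonRank.summable_deviationTerm hq1 a M,
    (DysonRank.hasSum_gTerm hq hq1).summable,
    (DysonRank.hasSum_appell_double (pow_ne_zero 3 hq) (DysonRank.norm_cube_lt_one hq1)
      (by norm_num) (by simpa using DysonRank.norm_cube_lt_norm hq hq1)
      (by simpa using hq1)).summable⟩,
    ⟨fun n => ?_, DysonRank.one_sub_cube_zpow_mul_ne_zero hq hq1,
      DysonRank.theta_neg_one_ne_zero (DysonRank.norm_cube_lt_one hq1), ?_, ?_⟩,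
    ⟨h02, h12, ?_⟩, ?_, ?_, ?_, ?_⟩
  · rw [DysonRank.qPoch_mul_qPoch_odd hq]
    exact DysonRank.qPoch_ne_zero (DysonRank.one_sub_sq_pow_mul_neg_ne_zero hq1) _
  · rw [DysonRank.Jsingle_one hq hq1]
    exact DysonRank.qPochInf_self_ne_zero hq1
  · rw [DysonRank.Jbar_one_three]
    exact DysonRank.theta_neg_self_cube_ne_zero hq hq1
  · rw [h12, h02]; ring
  · rw [h03, DysonRank.J_one_two, DysonRank.Jbar_one_three]; ring
  · rw [h13, h23]
  · rw [h23, h03]; ring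
  · rw [h13, DysonRank.J_one_two, DysonRank.Jbar_one_three]; ring
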